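/- Let $G$ be a compact Lie group with normalised Haar measure $dx$, and let $\widehat G$ be the set of equivalence classes of continuous irreducible unitary representations of $G$. For every class choose a representative $\xi$, written in an orthonormal basis as a matrix function $\xi:G\to U(d_\xi)$, and put $\widehat f(\xi)=\int_G f(x)\,\xi(x)^*\,dx$. For $B\in\mathbb C^{d\times d}$ let $\|B\|_{op(\ell^\infty,\ell^\infty)}=\max_i\sum_j|B_{ij}|$. A continuous linear operator $A:C^\infty(G)\to\mathcal D'(G)$ is said to have the matrix symbol $\sigma$ if for every $[\xi]\in\widehat G$ the distributions $A\xi_{ij}$ are integrable functions and, with $(A\xi)_{ij}=A\xi_{ij}$, one has $\sigma(x,\xi)=\xi(x)^*(A\xi)(x)$ for almost every $x\in G$. For $0<r\le 1$, a bounded linear operator $T:E\to F$ between Banach spaces is $r$-nuclear if there are $x_n'\in E'$ and $y_n\in F$ with $Tx=\sum_n\langle x,x_n'\rangle y_n$ for all $x\in E$ and $\sum_n\|x_n'\|_{E'}^r\|y_n\|_F^r<\infty$. Let $0<r\le 1$ and $1\le p_1,p_2<\infty$, and put $\widetilde{p_1}=\min\{2,p_1\}$. For every $[\xi]\in\widehat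 G$ let $\sigma(\cdot,\xi):G\to\mathbb C^{d_\xi\times d_\xi}$ be measurable (no further regularity is assumed), and suppose that $$\sum_{[\xi]\in\widehat G}d_\xi^{\,2+\frac{r}{\widetilde{p_1}}}\,\Big\|\,\|\sigma(x,\xi)^t\|_{op(\ell^\infty,\ell^\infty)}\Big\|_{L^{p_2}(G)}^r<\infty .$$ Then there is an $r$-nuclear operator $T:L^{p_1}(G)\to L^{p_2}(G)$ such that: 1. for every $f\in L^{p_1}(G)$, for almost every $x\in G$, the following series converges absolutely and $$Tf(x)=\sum_{[\xi]\in\widehat G}d_\xi\operatorname{Tr}\big(\xi(x)\,\sigma(x,\xi)\,\widehat f(\xi)\big);$$ 2. $T$ extends every operator with the symbol $\sigma$: if $A:C^\infty(G)\to\mathcal D'(G)$ is continuous, linear and has the matrix symbol $\sigma$, then $Af=Tf$ in $\mathcal D'(G)$ for all $f\in C^\infty(G)$. -/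

import Mathlib

open MeasureTheory Filter Topology
open scoped Manifold ContDiff ENNReal NNReal Matrix

noncomputable section

namespace RNuclear

/-! ### `r`-nuclear operators -/

/-- A bounded operator `T : E → F` between complex Banach spaces is `r`-nuclear if
`T x = ∑ ⟨x, x'ₙ⟩ yₙ` for all `x`, with `∑ ‖x'ₙ‖ ^ r * ‖yₙ‖ ^ r < ∞`. -/
def IsRNuclear {E F : Type*} [NormedAddCommGroup E] [NormedSpace ℂ E]
    [NormedAddCommGroup F] [NormedSpace ℂ F] (r : ℝ) (T : E →L[ℂ] F) : Prop :=
  ∃ (x' : ℕ → E →L[ℂ] ℂ) (y : ℕ → F),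
    (∀ x : E, HasSum (fun n => x' n x • y n) (T x)) ∧
      Summable (fun n => ‖x' n‖ ^ r * ‖y n‖ ^ r)

/-! ### The unitary dual -/

/-- The representation on `ℂⁿ` given by a homomorphism into the unitary group `U(n)`. -/
def matrixRep {G : Type*} [Group G] {n : ℕ} (ρ : G →* Matrix.unitaryGroup (Fin n) ℂ) :
    Representation ℂ G (Fin n → ℂ) where
  toFun g := Matrix.toLin' (ρ g : Matrix (Fin n) (Fin n) ℂ)
  map_one' := by simp; rfl
  map_mul' g h := by simp [Matrix.toLin'_mul]; rfl

/-- A continuous irreducible unitary representation of `G`, written in an orthonormal basis of the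
representation space, i.e. as a homomorphism to some `U(d)`. (For compact `G`, every continuous
irreducible unitary representation on a Hilbert space is of this form.) -/
structure IrrepMatrix (G : Type*) [Group G] [TopologicalSpace G] where
  /-- The dimension `d_ξ`. -/
  dim : ℕ
  /-- The unitary matrices `ξ(x)`. -/
  hom : G →* Matrix.unitaryGroup (Fin dim) ℂ
  continuous_hom : Continuous hom
  irreducible : (matrixRep hom).IsIrreducible

section Dual

variable {G : Type*} [Group G] [TopologicalSpace G]

/-- The matrix `ξ(x)`. -/
def IrrepMatrix.mat (ξ : IrrepMatrix G) (x : G) : Matrix (Fin ξ.dim) (Fin ξ.dim) ℂ :=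
  (ξ.hom x : Matrix (Fin ξ.dim) (Fin ξ.dim) ℂ)

/-- Unitary equivalence of representations. -/
def IrrepMatrix.Equivalent (ξ η : IrrepMatrix G) : Prop :=
  ∃ U : Matrix (Fin η.dim) (Fin ξ.dim) ℂ, Uᴴ * U = 1 ∧ U * Uᴴ = 1 ∧
    ∀ x, U * ξ.mat x = η.mat x * U

variable (G) in
instance irrepSetoid : Setoid (IrrepMatrix G) where
  r := IrrepMatrix.Equivalent
  iseqv :=
    { refl := fun ξ => ⟨1, by simp, by simp, fun x => by simp⟩
      symm := by
        rintro ξ η ⟨U, h1, h2, h⟩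
        refine ⟨Uᴴ, by simpa using h2, by simpa using h1, fun x => ?_⟩
        calc Uᴴ * η.mat x = Uᴴ * (η.mat x * U) * Uᴴ := by
              rw [Matrix.mul_assoc, Matrix.mul_assoc, h2, Matrix.mul_one]
          _ = (Uᴴ * U) * ξ.mat x * Uᴴ := by rw [← h x]; simp only [Matrix.mul_assoc]
          _ = ξ.mat x * Uᴴ := by rw [h1, Matrix.one_mul]
      trans := by
        rintro ξ η ζ ⟨U, h1, h2, h⟩ ⟨V, k1, k2, k⟩
        refine ⟨V * U, ?_, ?_, fun x => ?_⟩
        · rw [Matrix.conjTranspose_mul, Matrix.mul_assoc, ← Matrix.mul_assoc Vᴴ, k1,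
            Matrix.one_mul, h1]
        · rw [Matrix.conjTranspose_mul, Matrix.mul_assoc, ← Matrix.mul_assoc U, h2,
            Matrix.one_mul, k2]
        · rw [Matrix.mul_assoc, h x, ← Matrix.mul_assoc, k x, Matrix.mul_assoc] }

variable (G) in
/-- The unitary dual `Ĝ`: equivalence classes of continuous irreducible unitary representations. -/
def UnitaryDual : Type _ := Quotient (irrepSetoid G)

/-- `ξ` chooses a matrix representative `ξ c` of each class `c = [ξ] ∈ Ĝ`. -/
def IsChoiceOfRepresentatives (ξ : UnitaryDual G → IrrepMatrix G) : Prop :=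
  ∀ c : UnitaryDual G, Quotient.mk (irrepSetoid G) (ξ c) = c

end Dual

/-! ### Smooth functions and distributions -/

section Smooth

variable {E : Type*} [NormedAddCommGroup E] [NormedSpace ℝ E]
  {H : Type*} [TopologicalSpace H] (I : ModelWithCorners ℝ E H)
  (G : Type*) [TopologicalSpace G] [ChartedSpace H G]

/-- The complex vector space of smooth functions `G → ℂ`, as a subspace of all functions. -/
def smoothSubmodule : Submodule ℂ (G → ℂ) where
  carrier := {f | ContMDiff I 𝓘(ℝ, ℂ) ∞ f}
  add_mem' hf hg := ContMDiff.add hf hg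
  zero_mem' := contMDiff_const
  smul_mem' c f hf := by
    have h : ContMDiff I 𝓘(ℝ, ℂ) ∞ ((fun z : ℂ => c * z) ∘ f) :=
      (ContDiff.contMDiff (by fun_prop)).comp hf
    exact h

/-- The space `C^∞(G)`. -/
def SmoothFun : Type _ := smoothSubmodule I G

instance : AddCommGroup (SmoothFun I G) := inferInstanceAs (AddCommGroup (smoothSubmodule I G))

instance : Module ℂ (SmoothFun I G) := inferInstanceAs (Module ℂ (smoothSubmodule I G))

instance : CoeFun (SmoothFun I G) (fun _ => G → ℂ) := ⟨fun f => f.1⟩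

variable {I G}

theorem SmoothFun.continuous (f : SmoothFun I G) : Continuous (f : G → ℂ) :=
  ContMDiff.continuous (show ContMDiff I 𝓘(ℝ, ℂ) ∞ (f : G → ℂ) from f.2)

variable [Group G]

/-- The derivative `X_v f` of `f : G → ℂ` along the left-invariant vector field `X_v` whose value
at the identity is `v`. -/
def lieDeriv (v : GroupLieAlgebra I G) (f : G → ℂ) (x : G) : ℂ :=
  mfderiv I 𝓘(ℝ, ℂ) f x (mulInvariantVectorField v x)

/-- `X_{v₁} X_{v₂} ⋯ X_{vₖ} f` for the list `[v₁, …, vₖ]`. -/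
def iteratedLieDeriv (l : List (GroupLieAlgebra I G)) (f : G → ℂ) : G → ℂ :=
  l.foldr lieDeriv f

/-- The usual topology of `C^∞(G)` for compact `G`: uniform convergence of all iterated derivatives
along left-invariant vector fields (these fields span every tangent space). -/
instance : TopologicalSpace (SmoothFun I G) :=
  TopologicalSpace.induced
    (fun f (l : List (GroupLieAlgebra I G)) => UniformFun.ofFun (iteratedLieDeriv l (f : G → ℂ)))
    inferInstance

variable (I G) in
/-- The space `𝒟'(G)` of distributions on a compact Lie group: continuous linear functionals on
`C^∞(G)`, with the topology of pointwise convergence. -/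
abbrev Distrib : Type _ := SmoothFun I G →Lₚₜ[ℂ] ℂ

variable [MeasurableSpace G]

/-- The distribution `u` is given by the integrable function `g`. -/
def Distrib.IsRepresentedBy (u : Distrib I G) (g : G → ℂ) (μ : Measure G) : Prop :=
  Integrable g μ ∧ ∀ φ : SmoothFun I G, u φ = ∫ x, g x * φ x ∂μ

/-- A smooth function on a compact Lie group as an element of `L^p`. -/
def SmoothFun.toLp [CompactSpace G] [BorelSpace G] (f : SmoothFun I G) (p : ℝ≥0∞)
    (μ : Measure G) [IsFiniteMeasure μ] : Lp ℂ p μ :=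
  MemLp.toLp (f : G → ℂ)
    ((f.continuous.memLp_of_hasCompactSupport (HasCompactSupport.of_compactSpace _)))

/-! ### Matrix symbols -/

/-- `σ` is the matrix symbol of `A`: for each `[ξ]`, the distributions `A ξᵢⱼ` are given by
functions `(Aξ)ᵢⱼ`, and `σ(x, ξ) = ξ(x)^* (Aξ)(x)` for almost every `x`. (The matrix coefficients
`ξᵢⱼ` of a continuous representation of a Lie group are smooth, so that exactly one `u` with the
property below exists.) -/
def IsMatrixSymbol (A : SmoothFun I G →L[ℂ] Distrib I G) (μ : Measure G)
    (ξ : UnitaryDual G → IrrepMatrix G)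
    (σ : ∀ c : UnitaryDual G, G → Matrix (Fin (ξ c).dim) (Fin (ξ c).dim) ℂ) : Prop :=
  ∀ c : UnitaryDual G, ∃ Aξ : G → Matrix (Fin (ξ c).dim) (Fin (ξ c).dim) ℂ,
    (∀ i j, ∀ u : SmoothFun I G, (∀ x, u x = (ξ c).mat x i j) →
      (A u).IsRepresentedBy (fun x => Aξ x i j) μ) ∧
    ∀ᵐ x ∂μ, σ c x = ((ξ c).mat x)ᴴ * Aξ x

end Smooth

/-- The Fourier coefficient `f̂(ξ) = ∫ f(x) ξ(x)^* dx`, taken entrywise. -/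
def fourierCoeff {G : Type*} [Group G] [TopologicalSpace G] [MeasurableSpace G]
    (μ : Measure G) (f : G → ℂ) (ξ : IrrepMatrix G) : Matrix (Fin ξ.dim) (Fin ξ.dim) ℂ :=
  Matrix.of fun i j => ∫ x, f x * (ξ.mat x)ᴴ i j ∂μ

/-- The operator norm of a matrix on `(ℂ^d, ℓ^∞)`: the maximal absolute row sum. -/
def opNormLinfty {d : ℕ} (B : Matrix (Fin d) (Fin d) ℂ) : ℝ≥0 :=
  Finset.univ.sup fun i => ∑ j, ‖B i j‖₊

end RNuclear

end

/-!
Entrywise, `T f = ∑ f̂(ξ)ⱼᵢ · d_ξ (ξ σ)ᵢⱼ` is a sum of rank-one operators indexed by `(ξ, i, j)`.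
Since `‖ξ(x)‖ ≤ 1` entrywise, the `L^{p₂}` norm of `(ξ σ)ᵢⱼ` is at most that of the maximal absolute
column sum of `σ`. Schur orthogonality gives `‖ξᵢⱼ‖₂ = d_ξ^{-1/2}`, which Hölder's inequality and
`‖ξᵢⱼ‖_∞ ≤ 1` turn into the bound `d_ξ^{-(1 - 1/p̃₁)}` for the functional `f ↦ f̂(ξ)ⱼᵢ` on `L^{p₁}`.
The `d_ξ²` index pairs `(i, j)`, together with the factor `d_ξ^r · d_ξ^{-r (1 - 1/p̃₁)}` of each
term, account for the exponent `2 + r / p̃₁` in the hypothesis.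

An operator with symbol `σ` agrees with `T` on matrix coefficients by orthogonality, so what remains
is that these span a dense subspace of `C^∞(G)`. By Peter–Weyl (the spectral theorem for compact
self-adjoint convolution operators) finite combinations `k` of coefficients approximate the members
of an approximate identity in `L¹`. For smooth `f` the convolution `k * f` is again such a
combination, and it is close to `f` in `C^∞(G)` because convolution on the left commutes with
left-invariant derivatives.
-/

noncomputable section

namespace RNuclear

/-! ### Schur orthogonality -/

section Schur

theorem conjTranspose_mul_self_apply_self {m n : Type*} [Fintype m] (M : Matrix m n ℂ) (j : n) :
    (Mᴴ * M) j j = ((∑ k, ‖M k j‖ ^ 2 : ℝ) : ℂ) := by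
  simp only [Matrix.mul_apply, Matrix.conjTranspose_apply, Complex.ofReal_sum, Complex.ofReal_pow,
    Complex.star_def, Complex.conj_mul']

theorem exists_smul_unitary {m n : Type*} [Fintype m] [DecidableEq m] [Fintype n] [DecidableEq n]
    {M : Matrix m n ℂ} {c c' : ℂ} (hc : Mᴴ * M = c • 1) (hc' : M * Mᴴ = c' • 1) (hM : M ≠ 0) :
    ∃ a : ℂ, (a • M)ᴴ * (a • M) = 1 ∧ (a • M) * (a • M)ᴴ = 1 := by
  have hcc : c = c' := by
    have h : M * (Mᴴ * M) = (M * Mᴴ) * M := (Matrix.mul_assoc _ _ _).symm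
    rw [hc, hc', Matrix.mul_smul, Matrix.mul_one, Matrix.smul_mul, Matrix.one_mul] at h
    exact smul_left_injective _ hM h
  subst hcc
  obtain ⟨i, j, hij⟩ : ∃ i j, M i j ≠ 0 := by
    by_contra! h
    exact hM (Matrix.ext h)
  set t : ℝ := ∑ k, ‖M k j‖ ^ 2
  have hct : c = t := by
    rw [← conjTranspose_mul_self_apply_self, hc]
    simp
  have ht : 0 < t :=
    Finset.sum_pos' (fun _ _ => by positivity) ⟨i, Finset.mem_univ _, by positivity⟩
  have hs : (√t : ℂ)⁻¹ * (√t : ℂ)⁻¹ * c = 1 := by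
    rw [hct]
    norm_cast
    rw [← mul_inv, Real.mul_self_sqrt ht.le, inv_mul_cancel₀ ht.ne']
  have hstar : star ((√t : ℂ)⁻¹) = (√t : ℂ)⁻¹ := by simp
  refine ⟨(√t : ℂ)⁻¹, ?_, ?_⟩ <;>
    rw [Matrix.conjTranspose_smul, hstar, Matrix.smul_mul, Matrix.mul_smul, smul_smul]
  · rw [hc, smul_smul, hs, one_smul]
  · rw [hc', smul_smul, hs, one_smul]

variable {G : Type*} [Group G] [TopologicalSpace G]

namespace IrrepMatrix

variable (ξ η : IrrepMatrix G)

theorem mat_mul (x y : G) : ξ.mat (x * y) = ξ.mat x * ξ.mat y := by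
  simp [mat]

theorem mat_one : ξ.mat 1 = 1 := by
  simp [mat]

theorem mat_inv (x : G) : ξ.mat x⁻¹ = (ξ.mat x)ᴴ := by
  simp [mat, Matrix.star_eq_conjTranspose]

theorem mat_mul_conjTranspose (x : G) : ξ.mat x * (ξ.mat x)ᴴ = 1 := by
  rw [← mat_inv, ← mat_mul, mul_inv_cancel, mat_one]

theorem conjTranspose_mul_mat (x : G) : (ξ.mat x)ᴴ * ξ.mat x = 1 := by
  rw [← mat_inv, ← mat_mul, inv_mul_cancel, mat_one]

theorem continuous_mat_apply (i j : Fin ξ.dim) : Continuous fun x => ξ.mat x i j :=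
  (continuous_subtype_val.comp ξ.continuous_hom).matrix_elem i j

theorem norm_mat_apply_le (x : G) (i j : Fin ξ.dim) : ‖ξ.mat x i j‖ ≤ 1 :=
  entry_norm_bound_of_unitary (ξ.hom x).2 i j

theorem dim_pos : 0 < ξ.dim := by
  have := ξ.irreducible
  obtain ⟨a, b, hab⟩ := exists_pair_ne (Subrepresentation (matrixRep ξ.hom))
  refine Nat.pos_of_ne_zero fun h => hab (Subrepresentation.toSubmodule_injective ?_)
  have : IsEmpty (Fin ξ.dim) := h ▸ Fin.isEmpty
  exact Subsingleton.elim _ _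

theorem matrixRep_apply (x : G) (v : Fin ξ.dim → ℂ) : matrixRep ξ.hom x v = ξ.mat x *ᵥ v := by
  simp [matrixRep, mat]

theorem eq_smul_one_of_commute {M : Matrix (Fin ξ.dim) (Fin ξ.dim) ℂ}
    (hM : ∀ x, M * ξ.mat x = ξ.mat x * M) : ∃ c : ℂ, M = c • 1 := by
  have := ξ.irreducible
  let f : Representation.IntertwiningMap (matrixRep ξ.hom) (matrixRep ξ.hom) :=
    (Matrix.toLin' M).intertwiningMap_of_isIntertwiningMap _ _ (by
      intro g v
      simp only [Matrix.toLin'_apply, matrixRep_apply, Matrix.mulVec_mulVec, hM])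
  obtain ⟨c, hc⟩ :=
    (Representation.IsIrreducible.algebraMap_intertwiningMap_bijective_of_isAlgClosed
      (ρ := matrixRep ξ.hom)).2 f
  refine ⟨c, Matrix.toLin'.injective (LinearMap.ext fun v => ?_)⟩
  change f.toLinearMap v = _
  rw [← hc]
  simp [Representation.IntertwiningMap.algebraMap_apply]

variable {ξ η} in
theorem conjTranspose_intertwines {M : Matrix (Fin η.dim) (Fin ξ.dim) ℂ}
    (hM : ∀ x, M * ξ.mat x = η.mat x * M) (x : G) : Mᴴ * η.mat x = ξ.mat x * Mᴴ := by
  simpa [Matrix.conjTranspose_mul, mat_inv] using (congrArg Matrix.conjTranspose (hM x⁻¹)).symm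

variable {ξ η} in
theorem equivalent_of_intertwiner {M : Matrix (Fin η.dim) (Fin ξ.dim) ℂ}
    (hM : ∀ x, M * ξ.mat x = η.mat x * M) (h0 : M ≠ 0) : ξ.Equivalent η := by
  have hM' := conjTranspose_intertwines hM
  obtain ⟨c, hc⟩ := ξ.eq_smul_one_of_commute (M := Mᴴ * M) fun x => by
    rw [Matrix.mul_assoc, hM, ← Matrix.mul_assoc, hM', Matrix.mul_assoc]
  obtain ⟨c', hc'⟩ := η.eq_smul_one_of_commute (M := M * Mᴴ) fun x => by
    rw [Matrix.mul_assoc, hM', ← Matrix.mul_assoc, hM, Matrix.mul_assoc]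
  obtain ⟨a, h1, h2⟩ := exists_smul_unitary hc hc' h0
  exact ⟨a • M, h1, h2, fun x => by rw [Matrix.smul_mul, hM, Matrix.mul_smul]⟩

end IrrepMatrix

variable [CompactSpace G] [MeasurableSpace G]

theorem integrable_of_continuous {X F : Type*} [TopologicalSpace X] [CompactSpace X]
    [MeasurableSpace X] [OpensMeasurableSpace X] [NormedAddCommGroup F]
    {μ : Measure X} [IsFiniteMeasure μ] {f : X → F} (hf : Continuous f) : Integrable f μ :=
  hf.integrable_of_hasCompactSupport (HasCompactSupport.of_compactSpace f)

namespace IrrepMatrix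

variable (ξ η : IrrepMatrix G) (μ : Measure G)

/-- The average `∫ η(x) E ξ(x)^* dx`, taken entrywise, where `E` is the matrix unit with a `1` in
position `(j, l)`: the generic way to produce an intertwiner from `ξ` to `η`. -/
def average (j : Fin η.dim) (l : Fin ξ.dim) : Matrix (Fin η.dim) (Fin ξ.dim) ℂ :=
  Matrix.of fun i k => ∫ x, η.mat x i j * star (ξ.mat x k l) ∂μ

theorem integrable_mat_mul_star [OpensMeasurableSpace G] [IsFiniteMeasure μ] (i j : Fin η.dim)
    (k l : Fin ξ.dim) : Integrable (fun x => η.mat x i j * star (ξ.mat x k l)) μ :=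
  integrable_of_continuous ((η.continuous_mat_apply i j).mul (ξ.continuous_mat_apply k l).star)

theorem sum_integral_mat_mul_star [OpensMeasurableSpace G] [IsProbabilityMeasure μ]
    (j l : Fin ξ.dim) : ∑ i, ∫ x, ξ.mat x i j * star (ξ.mat x i l) ∂μ = if j = l then 1 else 0 := by
  calc ∑ i, ∫ x, ξ.mat x i j * star (ξ.mat x i l) ∂μ
      = ∫ x, ((ξ.mat x)ᴴ * ξ.mat x) l j ∂μ := by
        rw [← integral_finsetSum _ fun i _ => integrable_mat_mul_star ξ ξ μ i j i l]
        simp only [Matrix.mul_apply, Matrix.conjTranspose_apply, mul_comm]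
    _ = if j = l then 1 else 0 := by
        simp [ξ.conjTranspose_mul_mat, Matrix.one_apply, eq_comm]

variable [IsTopologicalGroup G] [BorelSpace G] [μ.IsMulLeftInvariant]

theorem average_eq_mul_average_mul [IsFiniteMeasure μ] (j : Fin η.dim) (l : Fin ξ.dim) (y : G) :
    average ξ η μ j l = η.mat y * average ξ η μ j l * (ξ.mat y)ᴴ := by
  have hint : ∀ (i a : Fin η.dim) (k b : Fin ξ.dim),
      Integrable
        (fun x => η.mat y i a * (η.mat x a j * star (ξ.mat x b l)) * star (ξ.mat y k b)) μ :=
    fun i a k b => ((integrable_mat_mul_star ξ η μ a j b l).const_mul _).mul_const _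
  ext i k
  calc ∫ x, η.mat x i j * star (ξ.mat x k l) ∂μ
      = ∫ x, η.mat (y * x) i j * star (ξ.mat (y * x) k l) ∂μ :=
        (integral_mul_left_eq_self _ y).symm
    _ = ∫ x, ∑ b, ∑ a,
          η.mat y i a * (η.mat x a j * star (ξ.mat x b l)) * star (ξ.mat y k b) ∂μ := by
        congr 1 with x
        simp only [mat_mul, Matrix.mul_apply, star_sum, star_mul', Finset.sum_mul_sum]
        rw [Finset.sum_comm]
        exact Finset.sum_congr rfl fun b _ => Finset.sum_congr rfl fun a _ => by ring
    _ = ∑ b, ∑ a, η.mat y i a * (∫ x, η.mat x a j * star (ξ.mat x b l) ∂μ)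
          * star (ξ.mat y k b) := by
        rw [integral_finsetSum _ fun b _ => integrable_finsetSum _ fun a _ => hint i a k b]
        refine Finset.sum_congr rfl fun b _ => ?_
        rw [integral_finsetSum _ fun a _ => hint i a k b]
        exact Finset.sum_congr rfl fun a _ => by rw [integral_mul_const, integral_const_mul]
    _ = (η.mat y * average ξ η μ j l * (ξ.mat y)ᴴ) i k := by
        simp only [Matrix.mul_apply, Finset.sum_mul, Matrix.conjTranspose_apply, average,
          Matrix.of_apply]

theorem average_intertwines [IsFiniteMeasure μ] (j : Fin η.dim) (l : Fin ξ.dim) (y : G) :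
    average ξ η μ j l * ξ.mat y = η.mat y * average ξ η μ j l := by
  conv_lhs => rw [average_eq_mul_average_mul ξ η μ j l y, Matrix.mul_assoc,
    ξ.conjTranspose_mul_mat, Matrix.mul_one]

variable {ξ η} in
theorem integral_mat_mul_star_of_not_equivalent [IsFiniteMeasure μ] (h : ¬ ξ.Equivalent η)
    (i j : Fin η.dim) (k l : Fin ξ.dim) : ∫ x, η.mat x i j * star (ξ.mat x k l) ∂μ = 0 := by
  by_contra h0
  exact h (equivalent_of_intertwiner (average_intertwines ξ η μ j l)
    fun h1 => h0 (congrFun (congrFun h1 i) k))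

theorem integral_mat_mul_star [IsProbabilityMeasure μ] (i j k l : Fin ξ.dim) :
    ∫ x, ξ.mat x i j * star (ξ.mat x k l) ∂μ = if i = k ∧ j = l then (ξ.dim : ℂ)⁻¹ else 0 := by
  obtain ⟨c, hc⟩ := ξ.eq_smul_one_of_commute (average_intertwines ξ ξ μ j l)
  have hentry : ∀ i k, ∫ x, ξ.mat x i j * star (ξ.mat x k l) ∂μ = if i = k then c else 0 := by
    intro i k
    simpa [average, Matrix.one_apply] using congrFun (congrFun hc i) k
  have htrace : (ξ.dim : ℂ) * c = if j = l then 1 else 0 := by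
    simpa only [hentry, if_true, Finset.sum_const, Finset.card_univ, Fintype.card_fin,
      nsmul_eq_mul] using sum_integral_mat_mul_star ξ μ j l
  have hd : (ξ.dim : ℂ) ≠ 0 := by exact_mod_cast ξ.dim_pos.ne'
  have hc' : c = if j = l then (ξ.dim : ℂ)⁻¹ else 0 := by
    rw [← mul_right_inj' hd, htrace]
    split_ifs <;> simp [hd]
  rw [hentry, hc', ← ite_and]

end IrrepMatrix

end Schur

/-! ### Convolution operators on a compact group -/

section InnerOperator

variable {X 𝕜 H : Type*} [TopologicalSpace X] [CompactSpace X] [RCLike 𝕜] [NormedAddCommGroup H]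
  [InnerProductSpace 𝕜 H]

/-- The operator `h ↦ (x ↦ ⟪κ x, h⟫)` from `H` to the continuous functions on `X`; an integral
operator with continuous kernel is the case `H = L²`. -/
def innerOp (κ : C(X, H)) : H →L[𝕜] C(X, 𝕜) :=
  LinearMap.mkContinuous
    { toFun := fun h => ⟨fun x => inner 𝕜 (κ x) h, by fun_prop⟩
      map_add' := fun a b => ContinuousMap.ext fun x => inner_add_right (κ x) a b
      map_smul' := fun c a => ContinuousMap.ext fun x => inner_smul_right (κ x) a c }
    ‖κ‖ fun h => (ContinuousMap.norm_le _ (by positivity)).2 fun x =>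
      (norm_inner_le_norm _ _).trans
        (mul_le_mul_of_nonneg_right (κ.norm_coe_le_norm x) (norm_nonneg _))

theorem equicontinuous_innerOp_closedBall (κ : C(X, H)) :
    Equicontinuous fun (h : Metric.closedBall (0 : H) 1) => ⇑(innerOp (𝕜 := 𝕜) κ h) := by
  intro x₀
  rw [Metric.equicontinuousAt_iff_right]
  intro ε hε
  filter_upwards [Metric.continuousAt_iff'.1 (κ.continuous.continuousAt (x := x₀)) ε hε]
  rintro x hx ⟨h, hh⟩
  rw [mem_closedBall_zero_iff] at hh
  rw [dist_comm, dist_eq_norm] at hx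
  calc dist (inner 𝕜 (κ x₀) h) (inner 𝕜 (κ x) h) = ‖inner 𝕜 (κ x₀ - κ x) h‖ := by
        rw [dist_eq_norm, inner_sub_left]
    _ ≤ ‖κ x₀ - κ x‖ * ‖h‖ := norm_inner_le_norm _ _
    _ ≤ ‖κ x₀ - κ x‖ * 1 := by gcongr
    _ < ε := by rwa [mul_one]

theorem isCompactOperator_innerOp (κ : C(X, H)) : IsCompactOperator (innerOp (𝕜 := 𝕜) κ) := by
  let A : Set (BoundedContinuousFunction X 𝕜) :=
    Set.range fun h : Metric.closedBall (0 : H) 1 =>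
      BoundedContinuousFunction.mkOfCompact (innerOp κ h)
  have hbound : ∀ (f : BoundedContinuousFunction X 𝕜) (x : X), f ∈ A →
      f x ∈ Metric.closedBall 0 ‖κ‖ := by
    rintro _ x ⟨⟨h, hh⟩, rfl⟩
    rw [mem_closedBall_zero_iff] at hh ⊢
    calc ‖inner 𝕜 (κ x) h‖ ≤ ‖κ x‖ * ‖h‖ := norm_inner_le_norm _ _
      _ ≤ ‖κ‖ * 1 := by gcongr; exact κ.norm_coe_le_norm x
      _ = ‖κ‖ := mul_one _
  have hequi : Equicontinuous ((↑) : A → X → 𝕜) := by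
    intro x₀ U hU
    filter_upwards [equicontinuous_innerOp_closedBall κ x₀ U hU] with x hx
    rintro ⟨_, h, rfl⟩
    exact hx h
  have hA : IsCompact (closure A) := BoundedContinuousFunction.arzela_ascoli
    (Metric.closedBall 0 ‖κ‖) (isCompact_closedBall _ _) A hbound hequi
  refine ⟨(ContinuousMap.isometryEquivBoundedOfCompact X 𝕜).symm '' closure A,
    hA.image (ContinuousMap.isometryEquivBoundedOfCompact X 𝕜).symm.continuous, ?_⟩
  filter_upwards [Metric.closedBall_mem_nhds (0 : H) one_pos] with h hh
  exact ⟨_, subset_closure ⟨⟨h, hh⟩, rfl⟩, by ext; rfl⟩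

end InnerOperator

section Convolution

variable {G : Type*} [Group G] [MeasurableSpace G] (μ : Measure G)

/-- The convolution `(k * f)(x) = ∫ k(x z⁻¹) f(z) dz`. -/
def groupConv (k f : G → ℂ) (x : G) : ℂ :=
  ∫ z, k (x * z⁻¹) * f z ∂μ

theorem groupConv_congr_ae {k f f' : G → ℂ} (h : f =ᵐ[μ] f') :
    groupConv μ k f = groupConv μ k f' := by
  funext x
  refine integral_congr_ae ?_
  filter_upwards [h] with z hz
  rw [hz]

theorem groupConv_comp_mul_right [MeasurableMul G] [μ.IsMulRightInvariant] (k f : G → ℂ) (g : G) :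
    groupConv μ k (fun x => f (x * g)) = fun x => groupConv μ k f (x * g) := by
  funext x
  simp only [groupConv]
  rw [← integral_mul_right_eq_self (fun z => k (x * g * z⁻¹) * f z) g]
  simp [mul_assoc]

theorem groupConv_eq_integral_mul_left [MeasurableMul G] [MeasurableInv G]
    [μ.IsMulLeftInvariant] [μ.IsInvInvariant] (k f : G → ℂ) (x : G) :
    groupConv μ k f x = ∫ y, k y * f (y⁻¹ * x) ∂μ := by
  rw [← integral_div_left_eq_self _ μ x, groupConv]
  simp [div_eq_mul_inv]

end Convolution

section CompactGroup

variable {G : Type*} [Group G] [TopologicalSpace G] [IsTopologicalGroup G] [CompactSpace G]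
  [MeasurableSpace G] [BorelSpace G] (μ : Measure G) [IsProbabilityMeasure μ] [μ.IsHaarMeasure]

instance isMulRightInvariant_of_compactSpace : μ.IsMulRightInvariant := by
  refine ⟨fun g => ?_⟩
  have : IsProbabilityMeasure (μ.map (· * g)) :=
    Measure.isProbabilityMeasure_map (measurable_mul_const g).aemeasurable
  exact Measure.isHaarMeasure_eq_of_isProbabilityMeasure _ _

instance isInvInvariant_of_compactSpace : μ.IsInvInvariant := by
  have : IsProbabilityMeasure μ.inv :=
    Measure.isProbabilityMeasure_map measurable_inv.aemeasurable
  have : μ.inv.IsOpenPosMeasure := continuous_inv.isOpenPosMeasure_map inv_surjective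
  have : μ.inv.IsHaarMeasure := {}
  exact ⟨Measure.isHaarMeasure_eq_of_isProbabilityMeasure _ _⟩

end CompactGroup

/-! ### The Peter–Weyl theorem -/

section Subrepresentation

variable {k Γ V W : Type*} [Field k] [Group Γ] [AddCommGroup V] [Module k V] [AddCommGroup W]
  [Module k W] {ρ : Representation k Γ V} {σ : Representation k Γ W}

/-- The image of a subrepresentation under an intertwining map. -/
def imageSubrepresentation (f : Representation.IntertwiningMap ρ σ) (S : Subrepresentation ρ) :
    Subrepresentation σ where
  toSubmodule := S.toSubmodule.map f.toLinearMap
  apply_mem_toSubmodule := by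
    rintro g _ ⟨v, hv, rfl⟩
    exact ⟨ρ g v, S.apply_mem_toSubmodule g hv, LinearMap.congr_fun (f.isIntertwining' g) v⟩

theorem imageSubrepresentation_injective {f : Representation.IntertwiningMap ρ σ}
    (hf : Function.Injective f) : Function.Injective (imageSubrepresentation f) := fun _ _ h =>
  Subrepresentation.toSubmodule_injective <|
    Submodule.map_injective_of_injective (f := f.toLinearMap) hf <|
      congrArg Subrepresentation.toSubmodule h

theorem imageSubrepresentation_bot (f : Representation.IntertwiningMap ρ σ) :
    imageSubrepresentation f ⊥ = ⊥ :=
  Subrepresentation.toSubmodule_injective (Submodule.map_bot f.toLinearMap)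

theorem imageSubrepresentation_mono (f : Representation.IntertwiningMap ρ σ) :
    Monotone (imageSubrepresentation f) := fun _ _ h => Submodule.map_mono h

theorem isIrreducible_of_isAtom {f : Representation.IntertwiningMap ρ σ}
    (hf : Function.Injective f) (h : IsAtom (imageSubrepresentation f ⊤)) : ρ.IsIrreducible where
  exists_pair_ne := ⟨⊥, ⊤, fun htriv => h.1 (htriv ▸ imageSubrepresentation_bot f)⟩
  eq_bot_or_eq_top S := by
    have hinj := imageSubrepresentation_injective hf
    rcases h.le_iff.1 (imageSubrepresentation_mono f (le_top : S ≤ ⊤)) with hS | hS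
    · exact Or.inl (hinj (hS.trans (imageSubrepresentation_bot f).symm))
    · exact Or.inr (hinj hS)

end Subrepresentation

section ContinuousLTwo

variable {X : Type*} [TopologicalSpace X] [CompactSpace X] [MeasurableSpace X] [BorelSpace X]
  {μ : Measure X} [IsFiniteMeasure μ]

theorem inner_toLp_left (f : C(X, ℂ)) (h : Lp ℂ 2 μ) :
    inner ℂ (ContinuousMap.toLp 2 μ ℂ f) h = ∫ x, star (f x) * h x ∂μ := by
  rw [L2.inner_def]
  refine integral_congr_ae ?_
  filter_upwards [ContinuousMap.coeFn_toLp (p := 2) (𝕜 := ℂ) μ f] with x hx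
  rw [hx, RCLike.inner_apply, mul_comm]
  rfl

theorem sum_inner_toLp_smul {ι : Type*} [Fintype ι] {e : ι → C(X, ℂ)}
    (he : Orthonormal ℂ fun i => ContinuousMap.toLp 2 μ ℂ (e i)) {f : C(X, ℂ)}
    (hf : f ∈ Submodule.span ℂ (Set.range e)) :
    ∑ i, inner ℂ (ContinuousMap.toLp 2 μ ℂ (e i)) (ContinuousMap.toLp 2 μ ℂ f) • e i = f := by
  obtain ⟨c, rfl⟩ := (Submodule.mem_span_range_iff_exists_fun ℂ).1 hf
  simp only [map_sum, map_smul, he.inner_right_fintype]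

variable (μ) in
theorem exists_orthonormal_toLp_span_eq [μ.IsOpenPosMeasure] (V : Submodule ℂ C(X, ℂ))
    [FiniteDimensional ℂ V] : ∃ e : Fin (Module.finrank ℂ V) → C(X, ℂ),
      Orthonormal ℂ (fun i => ContinuousMap.toLp 2 μ ℂ (e i)) ∧
        Submodule.span ℂ (Set.range e) = V := by
  let L : C(X, ℂ) →ₗ[ℂ] Lp ℂ 2 μ := (ContinuousMap.toLp 2 μ ℂ).toLinearMap
  have hL : Function.Injective L := ContinuousMap.toLp_injective μ
  let b : OrthonormalBasis (Fin (Module.finrank ℂ V)) ℂ (V.map L) :=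
    (stdOrthonormalBasis ℂ (V.map L)).reindex
      (finCongr (V.equivMapOfInjective L hL).finrank_eq.symm)
  choose e heb using fun i => (Submodule.mem_map.1 (b i).2).imp fun _ h => h.2
  refine ⟨e, ?_, Submodule.map_injective_of_injective hL ?_⟩
  · convert b.orthonormal.comp_linearIsometry (V.map L).subtypeₗᵢ using 1
    exact funext heb
  · rw [Submodule.map_span, ← Set.range_comp, show L ∘ e = (V.map L).subtype ∘ b from funext heb,
      Set.range_comp, ← Submodule.map_span, ← b.coe_toBasis, b.toBasis.span_eq,
      Submodule.map_subtype_top]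

/-- The continuous functions that are `L²`-orthogonal to `V`. -/
def orthogonalLTwo (μ : Measure X) [IsFiniteMeasure μ] (V : Submodule ℂ C(X, ℂ)) :
    Submodule ℂ C(X, ℂ) :=
  (V.map (ContinuousMap.toLp 2 μ ℂ).toLinearMap)ᗮ.comap (ContinuousMap.toLp 2 μ ℂ).toLinearMap

theorem mem_orthogonalLTwo {V : Submodule ℂ C(X, ℂ)} {f : C(X, ℂ)} :
    f ∈ orthogonalLTwo μ V ↔
      ∀ u ∈ V, inner ℂ (ContinuousMap.toLp 2 μ ℂ u) (ContinuousMap.toLp 2 μ ℂ f) = 0 := by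
  simp [orthogonalLTwo, Submodule.mem_orthogonal]

variable (μ) in
theorem isCompl_orthogonalLTwo [μ.IsOpenPosMeasure] (V : Submodule ℂ C(X, ℂ))
    [FiniteDimensional ℂ V] : IsCompl V (orthogonalLTwo μ V) := by
  constructor
  · refine Submodule.disjoint_def.2 fun f hf hf' =>
      ContinuousMap.toLp_injective (p := 2) (𝕜 := ℂ) μ ?_
    rw [map_zero, ← inner_self_eq_zero (𝕜 := ℂ)]
    exact mem_orthogonalLTwo.1 hf' f hf
  · refine codisjoint_iff_le_sup.2 fun f _ => ?_
    obtain ⟨_, ⟨u, hu, rfl⟩, z, hz, hsum⟩ := Submodule.exists_add_mem_mem_orthogonal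
      (K := V.map (ContinuousMap.toLp 2 μ ℂ).toLinearMap) (ContinuousMap.toLp 2 μ ℂ f)
    refine Submodule.mem_sup.2 ⟨u, hu, f - u, ?_, add_sub_cancel u f⟩
    rw [orthogonalLTwo, Submodule.mem_comap, map_sub]
    rwa [eq_sub_of_add_eq' hsum.symm] at hz

end ContinuousLTwo

section CoeffSpan

variable {G : Type*} [Group G] [TopologicalSpace G]

/-- The matrix coefficient `ξᵢⱼ` as a continuous function. -/
def IrrepMatrix.coeff (ξ : IrrepMatrix G) (i j : Fin ξ.dim) : C(G, ℂ) :=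
  ⟨fun x => ξ.mat x i j, ξ.continuous_mat_apply i j⟩

@[simp] theorem IrrepMatrix.coeff_apply (ξ : IrrepMatrix G) (i j : Fin ξ.dim) (x : G) :
    ξ.coeff i j x = ξ.mat x i j := rfl

variable (G) in
/-- The span of the matrix coefficients of the irreducible unitary representations. -/
def coeffSpan : Submodule ℂ C(G, ℂ) :=
  Submodule.span ℂ {f | ∃ (ξ : IrrepMatrix G) (i j : Fin ξ.dim), f = ξ.coeff i j}

theorem IrrepMatrix.coeff_mem_coeffSpan (ξ : IrrepMatrix G) (i j : Fin ξ.dim) :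
    ξ.coeff i j ∈ coeffSpan G :=
  Submodule.subset_span ⟨ξ, i, j, rfl⟩

end CoeffSpan

section RightRegular

variable {G : Type*} [Group G] [TopologicalSpace G] [IsTopologicalGroup G]

variable (G) in
/-- The right regular representation `(R_g f)(x) = f(x g)` on continuous functions. -/
def rightRegular : Representation ℂ G C(G, ℂ) where
  toFun g := (ContinuousMap.compRightAlgHom ℂ ℂ (ContinuousMap.mulRight g)).toLinearMap
  map_one' := by ext; simp
  map_mul' g h := by ext; simp [mul_assoc]

@[simp] theorem rightRegular_apply (g : G) (f : C(G, ℂ)) (x : G) :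
    rightRegular G g f x = f (x * g) := rfl

theorem continuous_rightRegular (f : C(G, ℂ)) : Continuous fun g => rightRegular G g f :=
  (ContinuousMap.curry ⟨fun p : G × G => f (p.2 * p.1), by fun_prop⟩).continuous

variable [CompactSpace G] [MeasurableSpace G] [BorelSpace G] (μ : Measure G)
  [IsFiniteMeasure μ]

theorem inner_toLp_rightRegular [μ.IsMulRightInvariant] (f h : C(G, ℂ)) (g : G) :
    inner ℂ (ContinuousMap.toLp 2 μ ℂ (rightRegular G g f))
        (ContinuousMap.toLp 2 μ ℂ (rightRegular G g h))
      = inner ℂ (ContinuousMap.toLp 2 μ ℂ f) (ContinuousMap.toLp 2 μ ℂ h) := by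
  rw [ContinuousMap.inner_toLp, ContinuousMap.inner_toLp]
  exact integral_mul_right_eq_self (fun x => h x * (starRingEnd ℂ) (f x)) g

section TranslationMatrix

variable {n : ℕ} (e : Fin n → C(G, ℂ))

/-- The matrix of the right translation by `g` in the `L²`-orthonormal family `e`. -/
def translationMatrix (g : G) : Matrix (Fin n) (Fin n) ℂ :=
  Matrix.of fun i j =>
    inner ℂ (ContinuousMap.toLp 2 μ ℂ (e i)) (ContinuousMap.toLp 2 μ ℂ (rightRegular G g (e j)))

theorem continuous_translationMatrix : Continuous (translationMatrix μ e) :=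
  continuous_matrix fun _ j => continuous_const.inner
    ((ContinuousMap.toLp 2 μ ℂ).continuous.comp (continuous_rightRegular (e j)))

variable {μ e} {W : Subrepresentation (rightRegular G)}
  (he : Orthonormal ℂ fun i => ContinuousMap.toLp 2 μ ℂ (e i))
  (heW : Submodule.span ℂ (Set.range e) = W.toSubmodule)

include he heW

theorem sum_translationMatrix_smul (g : G) (j : Fin n) :
    ∑ i, translationMatrix μ e g i j • e i = rightRegular G g (e j) :=
  sum_inner_toLp_smul he <| heW ▸ W.apply_mem_toSubmodule g
    (heW ▸ Submodule.subset_span (Set.mem_range_self j))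

theorem star_translationMatrix_mul_self [μ.IsMulRightInvariant] (g : G) :
    star (translationMatrix μ e g) * translationMatrix μ e g = 1 := by
  ext i j
  calc ∑ k, star (translationMatrix μ e g k i) * translationMatrix μ e g k j
      = inner ℂ (ContinuousMap.toLp 2 μ ℂ (rightRegular G g (e i)))
          (ContinuousMap.toLp 2 μ ℂ (rightRegular G g (e j))) := by
        rw [← sum_translationMatrix_smul he heW g i, map_sum, sum_inner]
        simp only [map_smul, inner_smul_left]
        rfl
    _ = (1 : Matrix (Fin n) (Fin n) ℂ) i j := by
        rw [inner_toLp_rightRegular, orthonormal_iff_ite.1 he, Matrix.one_apply]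

theorem translationMatrix_mul (g h : G) :
    translationMatrix μ e (g * h) = translationMatrix μ e g * translationMatrix μ e h := by
  ext i j
  have htranslate : rightRegular G (g * h) (e j)
      = ∑ k, translationMatrix μ e h k j • rightRegular G g (e k) := by
    rw [map_mul, Module.End.mul_apply, ← sum_translationMatrix_smul he heW h j, map_sum]
    simp only [map_smul]
  rw [translationMatrix, Matrix.of_apply, htranslate, map_sum, inner_sum, Matrix.mul_apply]
  simp only [map_smul, inner_smul_right]
  exact Finset.sum_congr rfl fun k _ => mul_comm _ _

/-- The unitary matrix representation given by right translations in an `L²`-orthonormal basis of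
a subrepresentation of the right regular representation. -/
def translationHom [μ.IsMulRightInvariant] : G →* Matrix.unitaryGroup (Fin n) ℂ where
  toFun g := ⟨translationMatrix μ e g,
    Matrix.mem_unitaryGroup_iff'.2 (star_translationMatrix_mul_self he heW g)⟩
  map_one' := Subtype.ext <| Matrix.ext fun i j => by
    simp [translationMatrix, orthonormal_iff_ite.1 he, Matrix.one_apply]
  map_mul' g h := Subtype.ext (translationMatrix_mul he heW g h)

theorem continuous_translationHom [μ.IsMulRightInvariant] :
    Continuous (translationHom he heW) :=
  (continuous_translationMatrix μ e).subtype_mk _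

/-- The embedding `c ↦ ∑ᵢ cᵢ eᵢ` of the representation `translationHom` into the right regular
representation. -/
def translationHomIntertwining [μ.IsMulRightInvariant] :
    Representation.IntertwiningMap (matrixRep (translationHom he heW)) (rightRegular G) :=
  (Fintype.linearCombination ℂ e).intertwiningMap_of_isIntertwiningMap _ _ fun g c => by
    change Fintype.linearCombination ℂ e (translationMatrix μ e g *ᵥ c)
      = rightRegular G g (Fintype.linearCombination ℂ e c)
    simp only [Fintype.linearCombination_apply, map_sum, map_smul,
      ← sum_translationMatrix_smul he heW g, Matrix.mulVec, dotProduct, Finset.sum_smul,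
      Finset.smul_sum, smul_smul]
    rw [Finset.sum_comm]
    simp only [mul_comm]

theorem translationHomIntertwining_injective [μ.IsMulRightInvariant] :
    Function.Injective (translationHomIntertwining he heW) :=
  LinearIndependent.fintypeLinearCombination_injective <|
    he.linearIndependent.of_comp (ContinuousMap.toLp 2 μ ℂ).toLinearMap

theorem imageSubrepresentation_translationHomIntertwining_top [μ.IsMulRightInvariant] :
    imageSubrepresentation (translationHomIntertwining he heW) ⊤ = W :=
  Subrepresentation.toSubmodule_injective <|
    ((Submodule.map_top _).trans (Fintype.range_linearCombination ℂ e)).trans heW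

theorem toSubmodule_le_coeffSpan_of_isAtom [μ.IsMulRightInvariant] (hW : IsAtom W) :
    W.toSubmodule ≤ coeffSpan G := by
  let η : IrrepMatrix G := ⟨n, translationHom he heW, continuous_translationHom he heW,
    isIrreducible_of_isAtom (translationHomIntertwining_injective he heW) <|
      (imageSubrepresentation_translationHomIntertwining_top he heW).symm ▸ hW⟩
  rw [← heW, Submodule.span_le]
  rintro _ ⟨j, rfl⟩
  have hcoeff : e j = ∑ i, e i 1 • η.coeff i j := by
    ext x
    have h := congrArg (fun f : C(G, ℂ) => f 1) (sum_translationMatrix_smul he heW x j)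
    simp only [rightRegular_apply, one_mul, ContinuousMap.sum_apply, ContinuousMap.smul_apply,
      smul_eq_mul] at h
    simp only [← h, ContinuousMap.sum_apply, ContinuousMap.smul_apply, smul_eq_mul]
    exact Finset.sum_congr rfl fun i _ => mul_comm _ _
  rw [hcoeff]
  exact Submodule.sum_mem _ fun i _ => Submodule.smul_mem _ _ (η.coeff_mem_coeffSpan i j)

end TranslationMatrix

/-- The `L²`-orthogonal complement of a subrepresentation of the right regular representation
within the continuous functions. -/
def orthogonalSubrepresentation [μ.IsMulRightInvariant] (F : Subrepresentation (rightRegular G)) :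
    Subrepresentation (rightRegular G) where
  toSubmodule := orthogonalLTwo μ F.toSubmodule
  apply_mem_toSubmodule g f hf := by
    rw [mem_orthogonalLTwo] at hf ⊢
    intro u hu
    have hug : rightRegular G g (rightRegular G g⁻¹ u) = u := by ext x; simp
    rw [← hug, inner_toLp_rightRegular]
    exact hf _ (F.apply_mem_toSubmodule g⁻¹ hu)

theorem toSubmodule_le_coeffSpan [μ.IsMulRightInvariant] [μ.IsOpenPosMeasure]
    (W : Subrepresentation (rightRegular G)) [FiniteDimensional ℂ W.toSubmodule] :
    W.toSubmodule ≤ coeffSpan G := by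
  induction hn : Module.finrank ℂ W.toSubmodule using Nat.strong_induction_on generalizing W with
  | _ n ih =>
  subst hn
  rcases eq_or_ne W ⊥ with rfl | hW
  · exact (bot_le : (⊥ : Submodule ℂ C(G, ℂ)) ≤ coeffSpan G)
  by_cases hatom : IsAtom W
  · obtain ⟨e, he, heW⟩ := exists_orthonormal_toLp_span_eq μ W.toSubmodule
    exact toSubmodule_le_coeffSpan_of_isAtom he heW hatom
  obtain ⟨F, hFW, hF⟩ : ∃ F < W, F ≠ ⊥ := by
    by_contra! h
    exact hatom ⟨hW, h⟩
  have hproper : ∀ S < W, S.toSubmodule ≤ coeffSpan G := by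
    intro S hS
    have hlt : S.toSubmodule < W.toSubmodule := hS
    have := Submodule.finiteDimensional_of_le hlt.le
    exact ih _ (Submodule.finrank_lt_finrank_of_lt hlt) S rfl
  have := Submodule.finiteDimensional_of_le (show F.toSubmodule ≤ W.toSubmodule from hFW.le)
  have hcompl := isCompl_orthogonalLTwo μ F.toSubmodule
  have hlt : W ⊓ orthogonalSubrepresentation μ F < W := by
    refine inf_le_left.lt_of_ne fun h => hF ?_
    have hle : F ≤ orthogonalSubrepresentation μ F := hFW.le.trans (inf_eq_left.1 h)
    exact Subrepresentation.toSubmodule_injective (hcompl.disjoint.eq_bot_of_le hle)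
  calc W.toSubmodule
      = F.toSubmodule ⊔ orthogonalLTwo μ F.toSubmodule ⊓ W.toSubmodule := by
        rw [← sup_inf_assoc_of_le _ (show F.toSubmodule ≤ W.toSubmodule from hFW.le),
          hcompl.sup_eq_top, top_inf_eq]
    _ ≤ coeffSpan G := sup_le (hproper F hFW) <| by
        rw [inf_comm]
        exact hproper _ hlt

end RightRegular

section ConvolutionOperator

variable {G : Type*} [Group G] [TopologicalSpace G] [IsTopologicalGroup G]

/-- The involution `φ†(x) = conj φ(x⁻¹)` of the convolution algebra. -/
def convStar (φ : C(G, ℂ)) : C(G, ℂ) :=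
  ⟨fun x => star (φ x⁻¹), by fun_prop⟩

@[simp] theorem convStar_apply (φ : C(G, ℂ)) (x : G) : convStar φ x = star (φ x⁻¹) := rfl

variable [CompactSpace G] [MeasurableSpace G] [BorelSpace G] (μ : Measure G) [IsFiniteMeasure μ]

theorem integral_star_groupConv_mul [SecondCountableTopology G] (φ : C(G, ℂ)) {h g : G → ℂ}
    (hh : Integrable h μ) (hg : Integrable g μ) :
    ∫ x, star (groupConv μ φ h x) * g x ∂μ
      = ∫ z, star (h z) * groupConv μ (convStar φ) g z ∂μ := by
  have hswap : Integrable (fun p : G × G => star (φ (p.1 * p.2⁻¹)) * (g p.1 * star (h p.2)))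
      (μ.prod μ) := by
    refine (hg.mul_prod (g := fun z => star (h z))
      (Complex.conjCLE.toContinuousLinearMap.integrable_comp hh)).bdd_mul (c := ‖φ‖)
      (Continuous.aestronglyMeasurable (by fun_prop)) (ae_of_all _ fun p => ?_)
    rw [norm_star]
    exact φ.norm_coe_le_norm _
  calc ∫ x, star (groupConv μ φ h x) * g x ∂μ
      = ∫ x, ∫ z, star (φ (x * z⁻¹)) * (g x * star (h z)) ∂μ ∂μ := by
        refine integral_congr_ae (ae_of_all _ fun x => ?_)
        simp only [groupConv, RCLike.star_def, ← integral_conj, ← integral_mul_const, map_mul]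
        exact integral_congr_ae (ae_of_all _ fun z => by ring)
    _ = ∫ z, ∫ x, star (φ (x * z⁻¹)) * (g x * star (h z)) ∂μ ∂μ := integral_integral_swap hswap
    _ = ∫ z, star (h z) * groupConv μ (convStar φ) g z ∂μ := by
        refine integral_congr_ae (ae_of_all _ fun z => ?_)
        simp only [groupConv, ← integral_const_mul]
        refine integral_congr_ae (ae_of_all _ fun x => ?_)
        simp only [convStar_apply, mul_inv_rev, inv_inv]
        ring

/-- Convolution with a continuous function, from `L²` to the continuous functions. -/
def convOp (φ : C(G, ℂ)) : Lp ℂ 2 μ →L[ℂ] C(G, ℂ) :=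
  innerOp <| ((ContinuousMap.toLp 2 μ ℂ : C(G, ℂ) →L[ℂ] Lp ℂ 2 μ) : C(C(G, ℂ), Lp ℂ 2 μ)).comp <|
    ContinuousMap.curry ⟨fun p : G × G => star (φ (p.1 * p.2⁻¹)), by fun_prop⟩

theorem convOp_apply (φ : C(G, ℂ)) (h : Lp ℂ 2 μ) (x : G) :
    convOp μ φ h x = groupConv μ φ h x := by
  refine (inner_toLp_left _ h).trans ?_
  simp [groupConv]

theorem convOp_convStar_one (φ : C(G, ℂ)) (h : Lp ℂ 2 μ) :
    convOp μ (convStar φ) h 1 = inner ℂ (ContinuousMap.toLp 2 μ ℂ φ) h := by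
  simp [convOp_apply, groupConv, inner_toLp_left]

theorem convOp_rightRegular [μ.IsMulRightInvariant] (φ f : C(G, ℂ)) (g : G) :
    convOp μ φ (ContinuousMap.toLp 2 μ ℂ (rightRegular G g f))
      = rightRegular G g (convOp μ φ (ContinuousMap.toLp 2 μ ℂ f)) := by
  ext x
  simp only [rightRegular_apply, convOp_apply,
    groupConv_congr_ae μ (ContinuousMap.coeFn_toLp μ _)]
  exact congrFun (groupConv_comp_mul_right μ φ f g) x

/-- Convolution with a continuous function, as an operator on `L²`. -/
def convL2 (φ : C(G, ℂ)) : Lp ℂ 2 μ →L[ℂ] Lp ℂ 2 μ :=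
  (ContinuousMap.toLp 2 μ ℂ).comp (convOp μ φ)

theorem isCompactOperator_convL2 (φ : C(G, ℂ)) : IsCompactOperator (convL2 μ φ) :=
  (isCompactOperator_innerOp _).clm_comp (ContinuousMap.toLp 2 μ ℂ)

variable {μ} in
theorem isSymmetric_convL2 [SecondCountableTopology G] {φ : C(G, ℂ)} (hφ : convStar φ = φ) :
    (convL2 μ φ : Lp ℂ 2 μ →ₗ[ℂ] Lp ℂ 2 μ).IsSymmetric := by
  intro h g
  have hint (u : Lp ℂ 2 μ) : Integrable u μ := (Lp.memLp u).integrable (by norm_num)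
  calc inner ℂ (ContinuousMap.toLp 2 μ ℂ (convOp μ φ h)) g
      = ∫ x, star (groupConv μ φ h x) * g x ∂μ := by simp only [inner_toLp_left, convOp_apply]
    _ = ∫ z, star (h z) * groupConv μ φ g z ∂μ := by
        rw [integral_star_groupConv_mul μ φ (hint h) (hint g), hφ]
    _ = inner ℂ h (ContinuousMap.toLp 2 μ ℂ (convOp μ φ g)) := by
        rw [← inner_conj_symm, inner_toLp_left, ← integral_conj]
        refine integral_congr_ae (ae_of_all _ fun z => ?_)
        simp [convOp_apply, mul_comm]

/-- The continuous eigenfunctions of the convolution operator with `φ` for the eigenvalue `l`. -/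
def convEigenfunctions [μ.IsMulRightInvariant] (φ : C(G, ℂ)) (l : ℂ) :
    Subrepresentation (rightRegular G) where
  toSubmodule := LinearMap.ker
    ((convOp μ φ ∘L ContinuousMap.toLp 2 μ ℂ : C(G, ℂ) →L[ℂ] C(G, ℂ)).toLinearMap
      - l • LinearMap.id)
  apply_mem_toSubmodule g f hf := by
    simp only [LinearMap.mem_ker, LinearMap.sub_apply, sub_eq_zero] at hf ⊢
    change convOp μ φ (ContinuousMap.toLp 2 μ ℂ f) = l • f at hf
    change convOp μ φ (ContinuousMap.toLp 2 μ ℂ (rightRegular G g f)) = l • rightRegular G g f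
    rw [convOp_rightRegular, hf, map_smul]

variable {μ}

theorem mem_convEigenfunctions [μ.IsMulRightInvariant] {φ f : C(G, ℂ)} {l : ℂ} :
    f ∈ (convEigenfunctions μ φ l).toSubmodule ↔
      convOp μ φ (ContinuousMap.toLp 2 μ ℂ f) = l • f := by
  rw [convEigenfunctions, LinearMap.mem_ker, LinearMap.sub_apply, sub_eq_zero]
  rfl

theorem map_toLp_convEigenfunctions [μ.IsMulRightInvariant] (φ : C(G, ℂ)) {l : ℂ} (hl : l ≠ 0) :
    (convEigenfunctions μ φ l).toSubmodule.map (ContinuousMap.toLp 2 μ ℂ).toLinearMap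
      = Module.End.eigenspace (convL2 μ φ : Lp ℂ 2 μ →ₗ[ℂ] Lp ℂ 2 μ) l := by
  apply le_antisymm
  · rintro _ ⟨f, hf, rfl⟩
    rw [Module.End.mem_eigenspace_iff]
    exact (congrArg (ContinuousMap.toLp 2 μ ℂ) (mem_convEigenfunctions.1 hf)).trans (map_smul _ _ _)
  · intro h hh
    have hconv : ContinuousMap.toLp 2 μ ℂ (convOp μ φ h) = l • h :=
      Module.End.mem_eigenspace_iff.1 hh
    have hh' : ContinuousMap.toLp 2 μ ℂ (l⁻¹ • convOp μ φ h) = h := by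
      rw [map_smul, hconv, smul_smul, inv_mul_cancel₀ hl, one_smul]
    refine ⟨l⁻¹ • convOp μ φ h, mem_convEigenfunctions.2 ?_, hh'⟩
    rw [hh', smul_smul, mul_inv_cancel₀ hl, one_smul]

variable [μ.IsMulRightInvariant] [μ.IsOpenPosMeasure]

theorem eigenspace_convL2_le (φ : C(G, ℂ)) {l : ℂ} (hl : l ≠ 0) :
    Module.End.eigenspace (convL2 μ φ : Lp ℂ 2 μ →ₗ[ℂ] Lp ℂ 2 μ) l
      ≤ (coeffSpan G).map (ContinuousMap.toLp 2 μ ℂ).toLinearMap := by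
  have hfin : FiniteDimensional ℂ
      (Module.End.eigenspace (convL2 μ φ : Lp ℂ 2 μ →ₗ[ℂ] Lp ℂ 2 μ) l) :=
    ContinuousLinearMap.finite_dimensional_eigenspace (isCompactOperator_convL2 μ φ) l hl
  rw [← map_toLp_convEigenfunctions φ hl] at hfin ⊢
  have : FiniteDimensional ℂ (convEigenfunctions μ φ l).toSubmodule :=
    (Submodule.equivMapOfInjective (ContinuousMap.toLp 2 μ ℂ).toLinearMap
      (ContinuousMap.toLp_injective μ) _).symm.finiteDimensional
  exact Submodule.map_mono (toSubmodule_le_coeffSpan μ _)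

variable [SecondCountableTopology G]

theorem convOp_eq_zero_of_mem_orthogonal {φ : C(G, ℂ)} (hφ : convStar φ = φ) {h : Lp ℂ 2 μ}
    (hh : h ∈ ((coeffSpan G).map (ContinuousMap.toLp 2 μ ℂ).toLinearMap)ᗮ) :
    convOp μ φ h = 0 := by
  have hsymm := isSymmetric_convL2 (μ := μ) hφ
  have horth : convL2 μ φ h ∈
      (⨆ l, Module.End.eigenspace (convL2 μ φ : Lp ℂ 2 μ →ₗ[ℂ] Lp ℂ 2 μ) l)ᗮ := by
    rw [← Submodule.iInf_orthogonal, Submodule.mem_iInf]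
    refine fun l => (Submodule.mem_orthogonal _ _).2 fun v hv => ?_
    have hmove : inner ℂ (convL2 μ φ v) h = inner ℂ v (convL2 μ φ h) := hsymm v h
    rw [← hmove, show convL2 μ φ v = l • v from Module.End.mem_eigenspace_iff.1 hv,
      inner_smul_left]
    rcases eq_or_ne l 0 with rfl | hl
    · rw [map_zero, zero_mul]
    · rw [(Submodule.mem_orthogonal _ _).1 hh v (eigenspace_convL2_le φ hl hv), mul_zero]
  rw [ContinuousLinearMap.orthogonalComplement_iSup_eigenspaces_eq_bot
    (isCompactOperator_convL2 μ φ) hsymm, Submodule.mem_bot] at horth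
  exact ContinuousMap.toLp_injective (p := 2) (𝕜 := ℂ) μ (horth.trans (map_zero _).symm)

theorem inner_toLp_eq_zero_of_mem_orthogonal {h : Lp ℂ 2 μ}
    (hh : h ∈ ((coeffSpan G).map (ContinuousMap.toLp 2 μ ℂ).toLinearMap)ᗮ) (f : C(G, ℂ)) :
    inner ℂ (ContinuousMap.toLp 2 μ ℂ f) h = 0 := by
  have hhermitian (φ : C(G, ℂ)) (hφ : convStar φ = φ) :
      inner ℂ (ContinuousMap.toLp 2 μ ℂ φ) h = 0 := by
    rw [← convOp_convStar_one, hφ, convOp_eq_zero_of_mem_orthogonal hφ hh, ContinuousMap.zero_apply]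
  have hadd := hhermitian (f + convStar f) (by ext; simp [add_comm])
  have hsub := hhermitian (Complex.I • (f - convStar f)) (by ext; simp; ring)
  rw [map_add, inner_add_left] at hadd
  rw [map_smul, map_sub, inner_smul_left, inner_sub_left] at hsub
  have hsub' := (mul_eq_zero.1 hsub).resolve_left (by simp)
  linear_combination (hadd + hsub') / 2

variable (μ) in
theorem orthogonal_coeffSpan_eq_bot [μ.WeaklyRegular] :
    ((coeffSpan G).map (ContinuousMap.toLp 2 μ ℂ).toLinearMap)ᗮ = ⊥ :=
  (Submodule.eq_bot_iff _).2 fun _ hh =>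
    (ContinuousMap.toLp_denseRange ℂ μ ℂ (by norm_num)).eq_zero_of_inner_right ℂ
      (inner_toLp_eq_zero_of_mem_orthogonal hh)

end ConvolutionOperator

section Dual

theorem countable_of_orthonormal {ι 𝕜 H : Type*} [RCLike 𝕜] [NormedAddCommGroup H]
    [InnerProductSpace 𝕜 H] [TopologicalSpace.SeparableSpace H] {v : ι → H} (hv : Orthonormal 𝕜 v) :
    Countable ι := by
  refine Pairwise.countable_of_isOpen_disjoint (s := fun i => Metric.ball (v i) (1 / 2))
    (fun i j hij => Metric.ball_disjoint_ball ?_) (fun _ => Metric.isOpen_ball)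
    (fun i => ⟨v i, Metric.mem_ball_self (by norm_num)⟩)
  have hsq : ‖v i - v j‖ ^ 2 = 2 := by
    rw [@norm_sub_sq 𝕜, hv.1 i, hv.1 j, hv.2 hij, map_zero]
    norm_num
  rw [dist_eq_norm]
  nlinarith [norm_nonneg (v i - v j)]

theorem integral_norm_le_norm_toLp {X : Type*} [TopologicalSpace X] [CompactSpace X]
    [MeasurableSpace X] [BorelSpace X] (μ : Measure X) [IsProbabilityMeasure μ] (p : ℝ≥0∞)
    [Fact (1 ≤ p)] (f : C(X, ℂ)) : ∫ x, ‖f x‖ ∂μ ≤ ‖ContinuousMap.toLp p μ ℂ f‖ := by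
  have hf : AEStronglyMeasurable f μ := f.continuous.aestronglyMeasurable
  have hLp : eLpNorm (ContinuousMap.toLp p μ ℂ f) p μ = eLpNorm f p μ :=
    eLpNorm_congr_ae (ContinuousMap.coeFn_toLp μ f)
  rw [integral_norm_eq_lintegral_enorm hf, ← eLpNorm_one_eq_lintegral_enorm, Lp.norm_def, hLp]
  exact ENNReal.toReal_mono (hLp ▸ Lp.eLpNorm_ne_top _)
    (eLpNorm_le_eLpNorm_of_exponent_le Fact.out hf)

variable {G : Type*} [Group G] [TopologicalSpace G]

theorem IrrepMatrix.coeff_eq_sum_of_equivalent {ξ η : IrrepMatrix G} (h : ξ.Equivalent η)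
    (i j : Fin η.dim) :
    ∃ t : Fin ξ.dim → Fin ξ.dim → ℂ, η.coeff i j = ∑ a, ∑ b, t a b • ξ.coeff a b := by
  obtain ⟨U, -, hU, hintertwine⟩ := h
  refine ⟨fun a b => U i a * Uᴴ b j, ?_⟩
  ext x
  have hconj : η.mat x = U * ξ.mat x * Uᴴ := by
    rw [hintertwine, Matrix.mul_assoc, hU, Matrix.mul_one]
  rw [coeff_apply, hconj, Matrix.mul_apply]
  simp only [ContinuousMap.sum_apply, ContinuousMap.smul_apply, smul_eq_mul, coeff_apply,
    Matrix.mul_apply, Finset.sum_mul]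
  rw [Finset.sum_comm]
  exact Finset.sum_congr rfl fun a _ => Finset.sum_congr rfl fun b _ => by ring

namespace IsChoiceOfRepresentatives

variable {ξ : UnitaryDual G → IrrepMatrix G} (hξ : IsChoiceOfRepresentatives ξ)

include hξ

theorem not_equivalent {c c' : UnitaryDual G} (h : c ≠ c') : ¬ (ξ c).Equivalent (ξ c') := fun he =>
  h (by rw [← hξ c, ← hξ c']; exact Quotient.sound he)

theorem coeffSpan_eq :
    coeffSpan G = Submodule.span ℂ {f | ∃ c i j, f = (ξ c).coeff i j} := by
  apply le_antisymm
  · refine Submodule.span_le.2 ?_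
    rintro _ ⟨η, i, j, rfl⟩
    obtain ⟨t, ht⟩ := IrrepMatrix.coeff_eq_sum_of_equivalent
      (Quotient.exact (hξ (Quotient.mk (irrepSetoid G) η))) i j
    rw [ht]
    exact Submodule.sum_mem _ fun a _ => Submodule.sum_mem _ fun b _ =>
      Submodule.smul_mem _ _ (Submodule.subset_span ⟨_, a, b, rfl⟩)
  · refine Submodule.span_mono ?_
    rintro _ ⟨c, i, j, rfl⟩
    exact ⟨ξ c, i, j, rfl⟩

variable [IsTopologicalGroup G] [CompactSpace G] [MeasurableSpace G] [BorelSpace G]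
  (μ : Measure G) [IsProbabilityMeasure μ] [μ.IsMulLeftInvariant]

theorem orthonormal_sqrt_dim_smul_coeff :
    Orthonormal ℂ fun c => ContinuousMap.toLp 2 μ ℂ
      ((√(ξ c).dim : ℂ) • (ξ c).coeff ⟨0, (ξ c).dim_pos⟩ ⟨0, (ξ c).dim_pos⟩) := by
  classical
  refine orthonormal_iff_ite.2 fun c c' => ?_
  rw [ContinuousMap.inner_toLp]
  simp only [ContinuousMap.smul_apply, smul_eq_mul, map_mul, Complex.conj_ofReal,
    IrrepMatrix.coeff_apply, ← RCLike.star_def, mul_mul_mul_comm]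
  rw [integral_const_mul]
  rcases eq_or_ne c c' with rfl | hc
  · rw [IrrepMatrix.integral_mat_mul_star, if_pos ⟨rfl, rfl⟩, if_pos rfl, ← Complex.ofReal_mul,
      Real.mul_self_sqrt (Nat.cast_nonneg _), Complex.ofReal_natCast]
    exact mul_inv_cancel₀ (Nat.cast_ne_zero.2 (ξ c).dim_pos.ne')
  · rw [IrrepMatrix.integral_mat_mul_star_of_not_equivalent μ (hξ.not_equivalent hc), mul_zero,
      if_neg hc]

include μ in
theorem countable_unitaryDual [SecondCountableTopology G] : Countable (UnitaryDual G) := by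
  have : Fact ((2 : ℝ≥0∞) ≠ ⊤) := ⟨by norm_num⟩
  exact countable_of_orthonormal (hξ.orthonormal_sqrt_dim_smul_coeff μ)

end IsChoiceOfRepresentatives

theorem exists_mem_coeffSpan_integral_norm_sub_lt [IsTopologicalGroup G] [CompactSpace G]
    [SecondCountableTopology G] [MeasurableSpace G] [BorelSpace G] (μ : Measure G)
    [IsProbabilityMeasure μ] [μ.IsHaarMeasure] (φ : C(G, ℂ)) {ε : ℝ} (hε : 0 < ε) :
    ∃ k ∈ coeffSpan G, ∫ x, ‖k x - φ x‖ ∂μ < ε := by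
  have hdense : Dense ((coeffSpan G).map (ContinuousMap.toLp 2 μ ℂ).toLinearMap :
      Set (Lp ℂ 2 μ)) :=
    Submodule.dense_iff_topologicalClosure_eq_top.2
      (Submodule.topologicalClosure_eq_top_iff.2 (orthogonal_coeffSpan_eq_bot μ))
  obtain ⟨_, hdist, k, hk, rfl⟩ := Metric.dense_iff.1 hdense (ContinuousMap.toLp 2 μ ℂ φ) ε hε
  refine ⟨k, hk, (integral_norm_le_norm_toLp μ 2 (k - φ)).trans_lt ?_⟩
  rwa [map_sub, ← dist_eq_norm]

end Dual

/-! ### Smooth dependence of integrals on parameters -/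

section Parametric

theorem continuous_of_continuousOn_univ_prod {X Y Z : Type*} [TopologicalSpace X]
    [TopologicalSpace Y] [TopologicalSpace Z] {f : X × Y → Z} {U : Set Y}
    (hf : ContinuousOn f (Set.univ ×ˢ U)) {u : Y} (hu : u ∈ U) : Continuous fun x => f (x, u) :=
  hf.comp_continuous (by fun_prop) fun _ => ⟨trivial, hu⟩

variable {E : Type*} [NormedAddCommGroup E] [NormedSpace ℝ E]
  {E' : Type*} [NormedAddCommGroup E'] [NormedSpace ℝ E']
  {H : Type*} [TopologicalSpace H] {J : ModelWithCorners ℝ E' H}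
  {M : Type*} [TopologicalSpace M] [ChartedSpace H M]
  {V : Type*} [NormedAddCommGroup V]

theorem contDiffAt_of_contMDiffOn_univ_prod [NormedSpace ℝ V] {F : M → E → V} {U : Set E}
    (hU : IsOpen U)
    (hF : ContMDiffOn (J.prod 𝓘(ℝ, E)) 𝓘(ℝ, V) ∞ (Function.uncurry F) (Set.univ ×ˢ U)) (y : M)
    {u : E} (hu : u ∈ U) : ContDiffAt ℝ ∞ (F y) u :=
  (ContMDiffAt.comp (I' := J.prod 𝓘(ℝ, E)) (g := Function.uncurry F) (f := fun w => (y, w)) u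
    (hF.contMDiffAt ((isOpen_univ.prod hU).mem_nhds ⟨trivial, hu⟩))
    (contMDiffAt_const.prodMk contMDiffAt_id)).contDiffAt

variable [IsManifold J ∞ M]

theorem contMDiffOn_fderiv_param [NormedSpace ℝ V] {F : M → E → V} {U : Set E} (hU : IsOpen U)
    (hF : ContMDiffOn (J.prod 𝓘(ℝ, E)) 𝓘(ℝ, V) ∞ (Function.uncurry F) (Set.univ ×ˢ U)) :
    ContMDiffOn (J.prod 𝓘(ℝ, E)) 𝓘(ℝ, E →L[ℝ] V) ∞
      (fun p : M × E => fderiv ℝ (F p.1) p.2) (Set.univ ×ˢ U) := by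
  rintro ⟨y, u⟩ hu
  have hFyu : ContMDiffAt (J.prod 𝓘(ℝ, E)) 𝓘(ℝ, V) ∞ (Function.uncurry F) (y, u) :=
    hF.contMDiffAt ((isOpen_univ.prod hU).mem_nhds hu)
  have hmfderiv := ContMDiffAt.mfderiv (I := 𝓘(ℝ, E)) (I' := 𝓘(ℝ, V)) (J := J.prod 𝓘(ℝ, E))
    (x₀ := (y, u)) (n := ∞) (m := ∞) (fun (p : M × E) (w : E) => F p.1 w) (fun p => p.2)
    (hFyu.comp_of_eq (f := fun q : (M × E) × E => (q.1.1, q.2)) (x := ((y, u), u))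
      ((contMDiffAt_fst.comp ((y, u), u) contMDiffAt_fst).prodMk contMDiffAt_snd) rfl)
    contMDiffAt_snd (by simp)
  refine (hmfderiv.congr_of_eventuallyEq (Eventually.of_forall fun p => ?_)).contMDiffWithinAt
  refine Eq.trans ?_ (congrFun (inTangentCoordinates_model_space _ _ _ _) p).symm
  exact (mfderiv_eq_fderiv (f := F p.1)).symm

variable [FiniteDimensional ℝ E] [NormedSpace ℂ V] [CompactSpace M] [MeasurableSpace M]
  [BorelSpace M] [SecondCountableTopology M] (μ : Measure M) [IsFiniteMeasure μ]

theorem hasFDerivAt_integral_param {F : M → E → V} {U : Set E} (hU : IsOpen U)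
    (hF : ContMDiffOn (J.prod 𝓘(ℝ, E)) 𝓘(ℝ, V) ∞ (Function.uncurry F) (Set.univ ×ˢ U))
    {k : M → ℂ} (hk : Continuous k) {u : E} (hu : u ∈ U) :
    HasFDerivAt (fun w => ∫ y, k y • F y w ∂μ) (∫ y, k y • fderiv ℝ (F y) u ∂μ) u := by
  have hFcont {w : E} (hw : w ∈ U) : Continuous fun y => F y w :=
    continuous_of_continuousOn_univ_prod hF.continuousOn hw
  have hderiv := (contMDiffOn_fderiv_param hU hF).continuousOn
  obtain ⟨ε, hε, hball⟩ := Metric.nhds_basis_closedBall.mem_iff.1 (hU.mem_nhds hu)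
  obtain ⟨C, hC⟩ := (isCompact_univ.prod (isCompact_closedBall u ε)).exists_bound_of_continuousOn
    (f := fun p : M × E => k p.1 • fderiv ℝ (F p.1) p.2)
    ((hk.comp continuous_fst).continuousOn.smul (hderiv.mono (Set.prod_mono le_rfl hball)))
  refine hasFDerivAt_integral_of_dominated_of_fderiv_le (bound := fun _ => C)
    (F' := fun w y => k y • fderiv ℝ (F y) w) (Metric.closedBall_mem_nhds u hε) ?_
    (integrable_of_continuous (hk.smul (hFcont hu)))
    (hk.smul (continuous_of_continuousOn_univ_prod hderiv hu)).aestronglyMeasurable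
    (ae_of_all _ fun y w hw => hC (y, w) ⟨trivial, hw⟩) (integrable_const _)
    (ae_of_all _ fun y w hw => ?_)
  · filter_upwards [hU.mem_nhds hu] with w hw
    exact (hk.smul (hFcont hw)).aestronglyMeasurable
  · exact ((contDiffAt_of_contMDiffOn_univ_prod hU hF y (hball hw)).differentiableAt
      (by simp)).hasFDerivAt.const_smul (k y)

theorem fderiv_integral_param_apply {F : M → E → V} {U : Set E} (hU : IsOpen U)
    (hF : ContMDiffOn (J.prod 𝓘(ℝ, E)) 𝓘(ℝ, V) ∞ (Function.uncurry F) (Set.univ ×ˢ U))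
    {k : M → ℂ} (hk : Continuous k) {u : E} (hu : u ∈ U) (v : E) :
    fderiv ℝ (fun w => ∫ y, k y • F y w ∂μ) u v = ∫ y, k y • fderiv ℝ (F y) u v ∂μ := by
  rw [(hasFDerivAt_integral_param μ hU hF hk hu).fderiv, ContinuousLinearMap.integral_apply]
  · rfl
  · exact integrable_of_continuous (hk.smul
      (continuous_of_continuousOn_univ_prod (contMDiffOn_fderiv_param hU hF).continuousOn hu))

theorem contDiffOn_integral_param {F : M → E → V} {U : Set E} (hU : IsOpen U)
    (hF : ContMDiffOn (J.prod 𝓘(ℝ, E)) 𝓘(ℝ, V) ∞ (Function.uncurry F) (Set.univ ×ˢ U))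
    {k : M → ℂ} (hk : Continuous k) (n : ℕ) :
    ContDiffOn ℝ n (fun w => ∫ y, k y • F y w ∂μ) U := by
  induction n generalizing F with
  | zero =>
    exact contDiffOn_zero.2 fun u hu =>
      (hasFDerivAt_integral_param μ hU hF hk hu).continuousAt.continuousWithinAt
  | succ n ih =>
    rw [Nat.cast_succ, contDiffOn_succ_iff_fderiv_of_isOpen hU]
    refine ⟨fun u hu => (hasFDerivAt_integral_param μ hU hF hk
      hu).differentiableAt.differentiableWithinAt, fun h => by simp at h, ?_⟩
    refine contDiffOn_clm_apply.2 fun v => ?_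
    refine (ih (F := fun y w => fderiv ℝ (F y) w v) fun p hp => ?_).congr fun u hu =>
      fderiv_integral_param_apply μ hU hF hk hu v
    exact (contMDiffOn_fderiv_param hU hF p hp).clm_apply contMDiffWithinAt_const

end Parametric

section Manifold

variable {E : Type*} [NormedAddCommGroup E] [NormedSpace ℝ E]
  {H : Type*} [TopologicalSpace H] {I : ModelWithCorners ℝ E H}
  {N : Type*} [TopologicalSpace N] [ChartedSpace H N]
  {V : Type*} [NormedAddCommGroup V]

variable (I) in
/-- The derivative of a vector-valued function in the direction of a tangent vector, as an element
of the target space itself rather than of its tangent space. -/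
def dirDeriv [NormedSpace ℝ V] (h : N → V) (x : N) (v : TangentSpace I x) : V :=
  mfderiv I 𝓘(ℝ, V) h x v

theorem dirDeriv_eq_fderiv_comp_extChartAt_symm [I.Boundaryless] [NormedSpace ℝ V] {h : N → V}
    {x : N} (hh : MDifferentiableAt I 𝓘(ℝ, V) h x) (v : TangentSpace I x) :
    dirDeriv I h x v = fderiv ℝ (h ∘ (extChartAt I x).symm) (extChartAt I x x) (v : E) := by
  rw [dirDeriv, hh.mfderiv, I.range_eq_univ, fderivWithin_univ]
  rfl

variable {E' : Type*} [NormedAddCommGroup E'] [NormedSpace ℝ E']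
  {H' : Type*} [TopologicalSpace H'] {J : ModelWithCorners ℝ E' H'}
  {M : Type*} [TopologicalSpace M] [ChartedSpace H' M]

theorem contMDiff_of_contMDiff_uncurry [NormedSpace ℝ V] {F : M → N → V}
    (hF : ContMDiff (J.prod I) 𝓘(ℝ, V) ∞ (Function.uncurry F)) (y : M) :
    ContMDiff I 𝓘(ℝ, V) ∞ (F y) :=
  hF.comp (f := fun z => (y, z)) (contMDiff_const.prodMk contMDiff_id)

variable [IsManifold I ∞ N]

theorem contMDiffOn_comp_extChartAt_symm [NormedSpace ℝ V] {F : M → N → V}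
    (hF : ContMDiff (J.prod I) 𝓘(ℝ, V) ∞ (Function.uncurry F)) (x : N) :
    ContMDiffOn (J.prod 𝓘(ℝ, E)) 𝓘(ℝ, V) ∞
      (Function.uncurry fun y u => F y ((extChartAt I x).symm u))
      (Set.univ ×ˢ (extChartAt I x).target) := by
  refine hF.comp_contMDiffOn (f := fun p : M × E => (p.1, (extChartAt I x).symm p.2)) ?_
  refine contMDiffOn_fst.prodMk ?_
  exact (contMDiffOn_extChartAt_symm x).comp contMDiffOn_snd fun p hp => hp.2

variable [I.Boundaryless] [IsManifold J ∞ M]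

theorem contMDiff_dirDeriv_param [NormedSpace ℝ V] {F : M → N → V}
    (hF : ContMDiff (J.prod I) 𝓘(ℝ, V) ∞ (Function.uncurry F)) (x : N) (v : TangentSpace I x) :
    ContMDiff J 𝓘(ℝ, V) ∞ fun y => dirDeriv I (F y) x v := by
  have hfderiv : ContMDiff J 𝓘(ℝ, E →L[ℝ] V) ∞ fun y =>
      fderiv ℝ (F y ∘ (extChartAt I x).symm) (extChartAt I x x) :=
    (contMDiffOn_fderiv_param (isOpen_extChartAt_target x)
        (contMDiffOn_comp_extChartAt_symm hF x)).comp_contMDiff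
      (f := fun y => (y, extChartAt I x x)) (contMDiff_id.prodMk contMDiff_const)
      fun y => ⟨trivial, mem_extChartAt_target x⟩
  have happly : ContMDiff J 𝓘(ℝ, V) ∞ fun y =>
      fderiv ℝ (F y ∘ (extChartAt I x).symm) (extChartAt I x x) (v : E) :=
    hfderiv.clm_apply contMDiff_const
  exact happly.congr fun y => dirDeriv_eq_fderiv_comp_extChartAt_symm
    ((contMDiff_of_contMDiff_uncurry hF y).mdifferentiableAt (by simp)) v

variable [FiniteDimensional ℝ E] [NormedSpace ℂ V] [CompactSpace M] [MeasurableSpace M]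
  [BorelSpace M] [SecondCountableTopology M] (μ : Measure M) [IsFiniteMeasure μ]
  {F : M → N → V} (hF : ContMDiff (J.prod I) 𝓘(ℝ, V) ∞ (Function.uncurry F))
  {k : M → ℂ} (hk : Continuous k)

include hF hk

theorem contMDiff_integral_param : ContMDiff I 𝓘(ℝ, V) ∞ fun x => ∫ y, k y • F y x ∂μ := by
  intro x
  have hchart : ContDiffOn ℝ ∞ (fun u => ∫ y, k y • F y ((extChartAt I x).symm u) ∂μ)
      (extChartAt I x).target :=
    contDiffOn_infty.2 fun n => contDiffOn_integral_param μ (isOpen_extChartAt_target x)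
      (contMDiffOn_comp_extChartAt_symm hF x) hk n
  have hcomp : ContMDiffAt I 𝓘(ℝ, V) ∞
      ((fun u => ∫ y, k y • F y ((extChartAt I x).symm u) ∂μ) ∘ extChartAt I x) x :=
    ((hchart.contDiffAt ((isOpen_extChartAt_target x).mem_nhds
      (mem_extChartAt_target x))).contMDiffAt).comp x contMDiffAt_extChartAt
  refine hcomp.congr_of_eventuallyEq ?_
  filter_upwards [extChartAt_source_mem_nhds (I := I) x] with z hz
  simp only [Function.comp_apply, (extChartAt I x).left_inv hz]

theorem dirDeriv_integral_param (x : N) (v : TangentSpace I x) :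
    dirDeriv I (fun x => ∫ y, k y • F y x ∂μ) x v = ∫ y, k y • dirDeriv I (F y) x v ∂μ := by
  rw [dirDeriv_eq_fderiv_comp_extChartAt_symm
    ((contMDiff_integral_param μ hF hk).mdifferentiableAt (by simp))]
  refine (fderiv_integral_param_apply μ (isOpen_extChartAt_target x)
    (contMDiffOn_comp_extChartAt_symm hF x) hk (mem_extChartAt_target x) v).trans
    (integral_congr_ae (ae_of_all _ fun y => ?_))
  simp only [dirDeriv_eq_fderiv_comp_extChartAt_symm
    ((contMDiff_of_contMDiff_uncurry hF y).mdifferentiableAt (by simp))]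
  rfl

end Manifold

/-! ### Approximate identities -/

section ApproximateIdentity

variable {G : Type*} [Group G] [TopologicalSpace G]

/-- Continuous probability densities `φ n` with respect to `μ` whose supports shrink to the
identity. -/
structure IsApproximateIdentity [MeasurableSpace G] (μ : Measure G) (φ : ℕ → G → ℝ) : Prop where
  continuous (n : ℕ) : Continuous (φ n)
  nonneg (n : ℕ) (x : G) : 0 ≤ φ n x
  integral_eq_one (n : ℕ) : ∫ x, φ n x ∂μ = 1
  eventually_support_subset : ∀ U ∈ 𝓝 (1 : G), ∀ᶠ n in atTop, Function.support (φ n) ⊆ U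

theorem IsApproximateIdentity.continuous_ofReal [MeasurableSpace G] {μ : Measure G}
    {φ : ℕ → G → ℝ} (hφ : IsApproximateIdentity μ φ) (n : ℕ) :
    Continuous fun x => (φ n x : ℂ) :=
  Complex.continuous_ofReal.comp (hφ.continuous n)

variable [IsTopologicalGroup G] [CompactSpace G]

theorem eventually_norm_inv_mul_sub_lt {V : Type*} [NormedAddCommGroup V] {g : G → V}
    (hg : Continuous g) {ε : ℝ} (hε : 0 < ε) :
    ∀ᶠ y in 𝓝 (1 : G), ∀ x, ‖g (y⁻¹ * x) - g x‖ < ε := by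
  let translate : C(G, C(G, V)) := ContinuousMap.curry ⟨fun p => g (p.1⁻¹ * p.2), by fun_prop⟩
  filter_upwards [translate.continuous.continuousAt (Metric.ball_mem_nhds _ hε)] with y hy x
  simpa [translate, dist_eq_norm] using
    (ContinuousMap.dist_apply_le_dist (f := translate y) (g := translate 1) x).trans_lt hy

variable [MeasurableSpace G] [BorelSpace G] (μ : Measure G) [IsProbabilityMeasure μ]
  [μ.IsHaarMeasure]

theorem norm_groupConv_sub_le {k k' g : G → ℂ} (hk : Continuous k) (hk' : Continuous k')
    (hg : Continuous g) {C : ℝ} (hC : ∀ x, ‖g x‖ ≤ C) (x : G) :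
    ‖groupConv μ k g x - groupConv μ k' g x‖ ≤ (∫ y, ‖k y - k' y‖ ∂μ) * C := by
  have hint {q : G → ℂ} (hq : Continuous q) : Integrable (fun y => q y * g (y⁻¹ * x)) μ :=
    integrable_of_continuous (by fun_prop)
  rw [groupConv_eq_integral_mul_left, groupConv_eq_integral_mul_left,
    ← integral_sub (hint hk) (hint hk'), ← integral_mul_const]
  refine norm_integral_le_of_norm_le (integrable_of_continuous (by fun_prop))
    (ae_of_all _ fun y => ?_)
  rw [← sub_mul, norm_mul]
  exact mul_le_mul_of_nonneg_left (hC _) (norm_nonneg _)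

namespace IsApproximateIdentity

variable {μ} {φ : ℕ → G → ℝ} (hφ : IsApproximateIdentity μ φ)

include hφ

theorem norm_groupConv_sub_self_le {g : G → ℂ} (hg : Continuous g) {ε : ℝ} {n : ℕ}
    (hn : ∀ y ∈ Function.support (φ n), ∀ x, ‖g (y⁻¹ * x) - g x‖ ≤ ε) (x : G) :
    ‖groupConv μ (fun y => (φ n y : ℂ)) g x - g x‖ ≤ ε := by
  have hφn := hφ.continuous_ofReal n
  have hmean (c : ℂ) : ∫ y, (φ n y : ℂ) * c ∂μ = c := by
    rw [integral_mul_const, integral_complex_ofReal, hφ.integral_eq_one, Complex.ofReal_one,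
      one_mul]
  have hsub : groupConv μ (fun y => (φ n y : ℂ)) g x - g x
      = ∫ y, (φ n y : ℂ) * (g (y⁻¹ * x) - g x) ∂μ := by
    simp_rw [mul_sub]
    rw [integral_sub (integrable_of_continuous (by fun_prop))
      (integrable_of_continuous (by fun_prop)), hmean, groupConv_eq_integral_mul_left]
  calc ‖groupConv μ (fun y => (φ n y : ℂ)) g x - g x‖ ≤ ∫ y, φ n y * ε ∂μ := by
        rw [hsub]
        refine norm_integral_le_of_norm_le
          (integrable_of_continuous ((hφ.continuous n).mul continuous_const))
          (ae_of_all _ fun y => ?_)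
        rw [norm_mul, Complex.norm_real, Real.norm_of_nonneg (hφ.nonneg n y)]
        rcases eq_or_ne (φ n y) 0 with hy | hy
        · rw [hy, zero_mul, zero_mul]
        · exact mul_le_mul_of_nonneg_left (hn y hy x) (hφ.nonneg n y)
    _ = ε := by rw [integral_mul_const, hφ.integral_eq_one, one_mul]

theorem tendstoUniformly_groupConv {g : G → ℂ} (hg : Continuous g) :
    TendstoUniformly (fun n => groupConv μ (fun y => (φ n y : ℂ)) g) g atTop := by
  refine Metric.tendstoUniformly_iff.2 fun ε hε => ?_
  filter_upwards [hφ.eventually_support_subset _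
    (eventually_norm_inv_mul_sub_lt hg (half_pos hε))] with n hn x
  rw [dist_comm, dist_eq_norm]
  exact (hφ.norm_groupConv_sub_self_le hg (fun y hy x => (hn hy x).le) x).trans_lt
    (half_lt_self hε)

theorem tendstoUniformly_groupConv_of_tendsto_integral {k : ℕ → G → ℂ}
    (hk : ∀ n, Continuous (k n)) (hkφ : Tendsto (fun n => ∫ x, ‖k n x - φ n x‖ ∂μ) atTop (𝓝 0))
    {g : G → ℂ} (hg : Continuous g) :
    TendstoUniformly (fun n => groupConv μ (k n) g) g atTop := by
  obtain ⟨C, hC⟩ := isCompact_univ.exists_bound_of_continuousOn hg.continuousOn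
  have hdiff : TendstoUniformly
      (fun n x => groupConv μ (k n) g x - groupConv μ (fun y => (φ n y : ℂ)) g x) 0 atTop := by
    refine Metric.tendstoUniformly_iff.2 fun ε hε => ?_
    have hlim := hkφ.mul_const C
    rw [zero_mul] at hlim
    filter_upwards [hlim.eventually_lt_const hε] with n hn x
    rw [Pi.zero_apply, dist_zero_left]
    exact (norm_groupConv_sub_le μ (hk n) (hφ.continuous_ofReal n) hg
      (fun x => hC x trivial) x).trans_lt hn
  have hadd := (hφ.tendstoUniformly_groupConv hg).add hdiff
  rw [add_zero] at hadd
  simpa only [Pi.add_def, add_sub_cancel] using hadd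

theorem exists_mem_coeffSpan_tendstoUniformly_groupConv [SecondCountableTopology G] :
    ∃ k : ℕ → C(G, ℂ), (∀ n, k n ∈ coeffSpan G) ∧ ∀ g : G → ℂ, Continuous g →
      TendstoUniformly (fun n => groupConv μ (k n) g) g atTop := by
  choose k hk hkφ using fun n : ℕ =>
    exists_mem_coeffSpan_integral_norm_sub_lt μ ⟨_, hφ.continuous_ofReal n⟩
      (Nat.one_div_pos_of_nat (α := ℝ) (n := n))
  have htendsto : Tendsto (fun n => ∫ x, ‖k n x - φ n x‖ ∂μ) atTop (𝓝 0) :=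
    squeeze_zero (fun n => integral_nonneg fun _ => norm_nonneg _) (fun n => (hkφ n).le)
      tendsto_one_div_add_atTop_nhds_zero_nat
  exact ⟨k, hk, fun g hg =>
    hφ.tendstoUniformly_groupConv_of_tendsto_integral (fun n => (k n).continuous) htendsto hg⟩

end IsApproximateIdentity

end ApproximateIdentity

section CoefficientConvolution

variable {G : Type*} [Group G] [TopologicalSpace G] [IsTopologicalGroup G] [CompactSpace G]
  [MeasurableSpace G] [BorelSpace G] (μ : Measure G) [IsFiniteMeasure μ]

theorem IrrepMatrix.groupConv_coeff (ξ : IrrepMatrix G) (i j : Fin ξ.dim) {f : G → ℂ}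
    (hf : Continuous f) (x : G) :
    groupConv μ (ξ.coeff i j) f x = (ξ.mat x * fourierCoeff μ f ξ) i j := by
  have hint (a : Fin ξ.dim) : Integrable (fun z => ξ.mat x i a * (f z * ξ.mat z⁻¹ a j)) μ :=
    integrable_of_continuous (continuous_const.mul
      (hf.mul ((ξ.continuous_mat_apply a j).comp continuous_inv)))
  simp only [groupConv, coeff_apply, fourierCoeff, ξ.mat_mul, Matrix.mul_apply, Matrix.of_apply,
    ← ξ.mat_inv, ← integral_const_mul, Finset.sum_mul]
  rw [← integral_finsetSum _ fun a _ => hint a]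
  exact integral_congr_ae (ae_of_all _ fun z =>
    Finset.sum_congr rfl fun a _ => by rw [mul_assoc, mul_comm (f z)])

theorem exists_mem_coeffSpan_eq_groupConv {k : C(G, ℂ)} (hk : k ∈ coeffSpan G) {f : G → ℂ}
    (hf : Continuous f) : ∃ h ∈ coeffSpan G, ⇑h = groupConv μ k f := by
  have hint (q : C(G, ℂ)) (x : G) : Integrable (fun z => q (x * z⁻¹) * f z) μ :=
    integrable_of_continuous (by fun_prop)
  induction hk using Submodule.span_induction with
  | mem q hq =>
    obtain ⟨ξ, i, j, rfl⟩ := hq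
    refine ⟨∑ a, fourierCoeff μ f ξ a j • ξ.coeff i a, Submodule.sum_mem _ fun a _ =>
      Submodule.smul_mem _ _ (ξ.coeff_mem_coeffSpan i a), funext fun x => ?_⟩
    rw [ξ.groupConv_coeff μ i j hf, ContinuousMap.sum_apply, Matrix.mul_apply]
    exact Finset.sum_congr rfl fun a _ => mul_comm _ _
  | zero => exact ⟨0, Submodule.zero_mem _, by ext x; simp [groupConv]⟩
  | add q q' _ _ hq hq' =>
    obtain ⟨u, hu, hu'⟩ := hq
    obtain ⟨v, hv, hv'⟩ := hq'
    refine ⟨u + v, Submodule.add_mem _ hu hv, funext fun x => ?_⟩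
    rw [ContinuousMap.add_apply, hu', hv']
    simp only [groupConv, ContinuousMap.add_apply, add_mul]
    rw [integral_add (hint q x) (hint q' x)]
  | smul c q _ hq =>
    obtain ⟨u, hu, hu'⟩ := hq
    refine ⟨c • u, Submodule.smul_mem _ _ hu, funext fun x => ?_⟩
    rw [ContinuousMap.smul_apply, hu']
    simp only [groupConv, ContinuousMap.smul_apply, smul_eq_mul, mul_assoc]
    rw [integral_const_mul]

theorem IsApproximateIdentity.tendsto_fourierCoeff {μ : Measure G} [IsProbabilityMeasure μ]
    [μ.IsHaarMeasure] {φ : ℕ → G → ℝ} (hφ : IsApproximateIdentity μ φ) (ξ : IrrepMatrix G) :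
    Tendsto (fun n => fourierCoeff μ (fun x => (φ n x : ℂ)) ξ) atTop (𝓝 1) := by
  refine tendsto_pi_nhds.2 fun a => tendsto_pi_nhds.2 fun b => ?_
  have hconv := (hφ.tendstoUniformly_groupConv (ξ.continuous_mat_apply a b)).tendsto_at 1
  rw [ξ.mat_one] at hconv
  refine hconv.congr fun n => ?_
  simp only [groupConv_eq_integral_mul_left, mul_one, ξ.mat_inv]
  rfl

end CoefficientConvolution

/-! ### Smooth functions on a compact Lie group -/

section Lie

variable {E : Type*} [NormedAddCommGroup E] [NormedSpace ℝ E]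
  {H : Type*} [TopologicalSpace H] {I : ModelWithCorners ℝ E H}
  {G : Type*} [TopologicalSpace G] [ChartedSpace H G] [Group G]

theorem SmoothFun.tendsto_iff {ι : Type*} {l : Filter ι} {u : ι → SmoothFun I G}
    {f : SmoothFun I G} :
    Tendsto u l (𝓝 f) ↔ ∀ L : List (GroupLieAlgebra I G),
      TendstoUniformly (fun i => iteratedLieDeriv L (u i)) (iteratedLieDeriv L f) l := by
  simp only [nhds_induced, tendsto_comap_iff, tendsto_pi_nhds,
    UniformFun.tendsto_iff_tendstoUniformly]
  rfl

variable [LieGroup I ∞ G] {f : G → ℂ}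

theorem lieDeriv_eq_dirDeriv_one (hf : ContMDiff I 𝓘(ℝ, ℂ) ∞ f) (v : GroupLieAlgebra I G)
    (x : G) : lieDeriv v f x = dirDeriv I (fun z => f (x * z)) 1 v := by
  have hchain : dirDeriv I (fun z => f (x * z)) 1 v
      = dirDeriv I f (x * 1) (mfderiv I I (fun z => x * z) 1 v) :=
    congrArg (fun D => D v) (mfderiv_comp (I' := I) (1 : G) (g := f) (f := fun z => x * z)
      (hf.mdifferentiableAt (by simp))
      ((contMDiff_mul_left (I := I) (n := ∞) (a := x)).mdifferentiableAt (by simp)))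
  have hbase (z : G) (hz : z = x) (w : E) : dirDeriv I f x w = dirDeriv I f z w := by rw [hz]
  rw [hchain]
  exact hbase _ (mul_one x) _

theorem lieDeriv_comp_mul_left (hf : ContMDiff I 𝓘(ℝ, ℂ) ∞ f) (v : GroupLieAlgebra I G)
    (y x : G) : lieDeriv v (fun z => f (y * z)) x = lieDeriv v f (y * x) := by
  have hfy : ContMDiff I 𝓘(ℝ, ℂ) ∞ fun z => f (y * z) := hf.comp contMDiff_mul_left
  rw [lieDeriv_eq_dirDeriv_one hf, lieDeriv_eq_dirDeriv_one hfy]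
  simp only [mul_assoc]

variable (I) in
theorem contMDiff_inv_mul_uncurry (hf : ContMDiff I 𝓘(ℝ, ℂ) ∞ f) :
    ContMDiff (I.prod I) 𝓘(ℝ, ℂ) ∞ (Function.uncurry fun y x : G => f (y⁻¹ * x)) :=
  hf.comp ((contMDiff_fst.inv).mul contMDiff_snd)

variable (I) in
theorem exists_smooth_isApproximateIdentity [FiniteDimensional ℝ E] [CompactSpace G]
    [T2Space G] [SecondCountableTopology G] [MeasurableSpace G] [BorelSpace G] (μ : Measure G)
    [IsFiniteMeasure μ] [μ.IsOpenPosMeasure] : ∃ φ : ℕ → G → ℝ,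
    IsApproximateIdentity μ φ ∧ ∀ n, ContMDiff I 𝓘(ℝ, ℝ) ∞ (φ n) := by
  have : IsManifold I ∞ G := ContMDiffMul.toIsManifold (n := ∞)
  obtain ⟨U, hU⟩ := (𝓝 (1 : G)).exists_antitone_basis
  choose b _ hb using fun n =>
    (SmoothBumpFunction.nhds_basis_tsupport (I := I) (1 : G)).mem_iff.1
      (hU.1.mem_of_mem (i := n) trivial)
  have hpos (n : ℕ) : 0 < ∫ x, b n x ∂μ :=
    (b n).continuous.integral_pos_of_hasCompactSupport_nonneg_nonzero
      (HasCompactSupport.of_compactSpace _) (fun _ => (b n).nonneg) (x := 1)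
      (by rw [(b n).eq_one]; exact one_ne_zero)
  refine ⟨fun n x => (∫ x, b n x ∂μ)⁻¹ * b n x, ?_, fun n => contMDiff_const.mul (b n).contMDiff⟩
  refine ⟨fun n => continuous_const.mul (b n).continuous,
    fun n x => mul_nonneg (inv_nonneg.2 (hpos n).le) (b n).nonneg, fun n => ?_, fun V hV => ?_⟩
  · rw [integral_const_mul, inv_mul_cancel₀ (hpos n).ne']
  · obtain ⟨m, -, hm⟩ := hU.1.mem_iff.1 hV
    filter_upwards [eventually_ge_atTop m] with n hn x hx
    exact hm (hU.2 hn (hb n (subset_tsupport _ (right_ne_zero_of_mul hx))))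

variable [I.Boundaryless]

theorem contMDiff_lieDeriv (hf : ContMDiff I 𝓘(ℝ, ℂ) ∞ f) (v : GroupLieAlgebra I G) :
    ContMDiff I 𝓘(ℝ, ℂ) ∞ (lieDeriv v f) := by
  have : IsManifold I ∞ G := ContMDiffMul.toIsManifold (n := ∞)
  have hmul : ContMDiff (I.prod I) 𝓘(ℝ, ℂ) ∞ (Function.uncurry fun x z : G => f (x * z)) :=
    hf.comp (contMDiff_mul I ∞)
  exact (contMDiff_dirDeriv_param hmul 1 v).congr fun x => lieDeriv_eq_dirDeriv_one hf v x

theorem contMDiff_iteratedLieDeriv (hf : ContMDiff I 𝓘(ℝ, ℂ) ∞ f)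
    (L : List (GroupLieAlgebra I G)) : ContMDiff I 𝓘(ℝ, ℂ) ∞ (iteratedLieDeriv L f) := by
  induction L with
  | nil => exact hf
  | cons v L ih => exact contMDiff_lieDeriv ih v

variable [FiniteDimensional ℝ E] [CompactSpace G] [MeasurableSpace G] [BorelSpace G]
  [SecondCountableTopology G]

variable [IsTopologicalGroup G] (μ : Measure G) [IsProbabilityMeasure μ] [μ.IsHaarMeasure]
  {k : G → ℂ} (hk : Continuous k)

include hk

theorem contMDiff_groupConv (hf : ContMDiff I 𝓘(ℝ, ℂ) ∞ f) :
    ContMDiff I 𝓘(ℝ, ℂ) ∞ (groupConv μ k f) := by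
  have : IsManifold I ∞ G := ContMDiffMul.toIsManifold (n := ∞)
  exact (contMDiff_integral_param μ (contMDiff_inv_mul_uncurry I hf) hk).congr
    (groupConv_eq_integral_mul_left μ k f)

theorem lieDeriv_groupConv (hf : ContMDiff I 𝓘(ℝ, ℂ) ∞ f) (v : GroupLieAlgebra I G) :
    lieDeriv v (groupConv μ k f) = groupConv μ k (lieDeriv v f) := by
  have : IsManifold I ∞ G := ContMDiffMul.toIsManifold (n := ∞)
  funext x
  rw [groupConv_eq_integral_mul_left, funext (groupConv_eq_integral_mul_left μ k f)]
  refine (dirDeriv_integral_param μ (contMDiff_inv_mul_uncurry I hf) hk x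
    (mulInvariantVectorField v x)).trans (integral_congr_ae (ae_of_all _ fun y => ?_))
  exact congrArg (k y * ·) (lieDeriv_comp_mul_left hf v y⁻¹ x)

theorem iteratedLieDeriv_groupConv (hf : ContMDiff I 𝓘(ℝ, ℂ) ∞ f)
    (L : List (GroupLieAlgebra I G)) :
    iteratedLieDeriv L (groupConv μ k f) = groupConv μ k (iteratedLieDeriv L f) := by
  induction L with
  | nil => rfl
  | cons v L ih =>
    exact (congrArg (lieDeriv v) ih).trans
      (lieDeriv_groupConv μ hk (contMDiff_iteratedLieDeriv hf L) v)

end Lie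

section SmoothCoefficients

variable {E : Type*} [NormedAddCommGroup E] [NormedSpace ℝ E] [FiniteDimensional ℝ E]
  {H : Type*} [TopologicalSpace H] {I : ModelWithCorners ℝ E H} [I.Boundaryless]
  {G : Type*} [Group G] [TopologicalSpace G] [ChartedSpace H G] [LieGroup I ∞ G]
  [IsTopologicalGroup G] [CompactSpace G] [T2Space G] [SecondCountableTopology G]
  [MeasurableSpace G] [BorelSpace G] (μ : Measure G) [IsProbabilityMeasure μ] [μ.IsHaarMeasure]

include μ

variable (I) in
/- For a smooth approximate identity `φ`, the coefficients of `ξ * φ n = ξ(x) (φ n)^(ξ)` are smooth,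
and `(φ n)^(ξ)` is invertible for large `n`. -/
theorem IrrepMatrix.contMDiff_mat_apply (ξ : IrrepMatrix G) (i j : Fin ξ.dim) :
    ContMDiff I 𝓘(ℝ, ℂ) ∞ fun x => ξ.mat x i j := by
  obtain ⟨φ, hφ, hsmooth⟩ := exists_smooth_isApproximateIdentity I μ
  have hdet := (Continuous.matrix_det continuous_id).continuousAt.tendsto.comp
    (hφ.tendsto_fourierCoeff ξ)
  rw [id, Matrix.det_one] at hdet
  obtain ⟨n, hn⟩ := (hdet.eventually_ne one_ne_zero).exists
  set B := fourierCoeff μ (fun x => (φ n x : ℂ)) ξ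
  have hB : B * B⁻¹ = 1 := Matrix.mul_nonsing_inv _ (isUnit_iff_ne_zero.2 hn)
  have hconv (a : Fin ξ.dim) : ContMDiff I 𝓘(ℝ, ℂ) ∞ fun x => (ξ.mat x * B) i a :=
    (contMDiff_groupConv μ (ξ.coeff i a).continuous
      (Complex.ofRealCLM.contDiff.contMDiff.comp (hsmooth n))).congr fun x =>
      (ξ.groupConv_coeff μ i a (hφ.continuous_ofReal n) x).symm
  have hsum : ContMDiff I 𝓘(ℝ, ℂ) ∞ fun x => ∑ a, (ξ.mat x * B) i a * B⁻¹ a j :=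
    contMDiff_finsetSum fun a _ =>
      ((ContinuousLinearMap.mul ℝ ℂ).flip (B⁻¹ a j)).contDiff.contMDiff.comp (hconv a)
  refine hsum.congr fun x => ?_
  rw [← Matrix.mul_apply, Matrix.mul_assoc, hB, Matrix.mul_one]

variable {S : Submodule ℂ (SmoothFun I G)} {ξ : UnitaryDual G → IrrepMatrix G}
  (hξ : IsChoiceOfRepresentatives ξ)
  (hmem : ∀ c i j (u : SmoothFun I G), (∀ x, u x = (ξ c).mat x i j) → u ∈ S)

include hξ hmem

theorem SmoothFun.mem_of_mem_coeffSpan {h : C(G, ℂ)} (hh : h ∈ coeffSpan G)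
    {u : SmoothFun I G} (hu : ∀ x, u x = h x) : u ∈ S := by
  suffices ∃ w ∈ S, ∀ x, w x = h x by
    obtain ⟨w, hwS, hw⟩ := this
    rwa [show u = w from Subtype.ext (funext fun x => (hu x).trans (hw x).symm)]
  clear hu
  rw [hξ.coeffSpan_eq] at hh
  induction hh using Submodule.span_induction with
  | mem q hq =>
    obtain ⟨c, i, j, rfl⟩ := hq
    let w : SmoothFun I G := ⟨fun x => (ξ c).mat x i j, (ξ c).contMDiff_mat_apply I μ i j⟩
    exact ⟨w, hmem c i j w fun _ => rfl, fun _ => rfl⟩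
  | zero => exact ⟨0, S.zero_mem, fun _ => rfl⟩
  | add q q' _ _ hq hq' =>
    obtain ⟨w, hw, hwq⟩ := hq
    obtain ⟨w', hw', hwq'⟩ := hq'
    exact ⟨w + w', S.add_mem hw hw', fun x => congrArg₂ (· + ·) (hwq x) (hwq' x)⟩
  | smul a q _ hq =>
    obtain ⟨w, hw, hwq⟩ := hq
    exact ⟨a • w, S.smul_mem a hw, fun x => congrArg (a * ·) (hwq x)⟩

theorem SmoothFun.eq_top_of_isClosed_of_coeff_mem (hS : IsClosed (S : Set (SmoothFun I G))) :
    S = ⊤ := by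
  refine eq_top_iff.2 fun f _ => ?_
  have hf : ContMDiff I 𝓘(ℝ, ℂ) ∞ (f : G → ℂ) := f.2
  obtain ⟨φ, hφ, -⟩ := exists_smooth_isApproximateIdentity I μ
  obtain ⟨k, hk, hlim⟩ := hφ.exists_mem_coeffSpan_tendstoUniformly_groupConv
  let u (n : ℕ) : SmoothFun I G :=
    ⟨groupConv μ (k n) f, contMDiff_groupConv μ (k n).continuous hf⟩
  have huS (n : ℕ) : u n ∈ S := by
    obtain ⟨h, hh, hconv⟩ := exists_mem_coeffSpan_eq_groupConv μ (hk n) f.continuous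
    exact mem_of_mem_coeffSpan μ hξ hmem hh fun x => (congrFun hconv x).symm
  refine hS.mem_of_tendsto (b := atTop) (f := u) (SmoothFun.tendsto_iff.2 fun L => ?_)
    (Eventually.of_forall huS)
  simpa only [u, iteratedLieDeriv_groupConv μ (k _).continuous hf L] using
    hlim _ (contMDiff_iteratedLieDeriv hf L).continuous

end SmoothCoefficients

/-! ### Sums of rank-one operators -/

section Nuclear

variable {E F ι : Type*}

theorem summable_of_summable_rpow {b : ι → ℝ} (hb : ∀ i, 0 ≤ b i) {r : ℝ} (hr0 : 0 < r)
    (hr1 : r ≤ 1) (h : Summable fun i => b i ^ r) : Summable b := by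
  refine Summable.of_norm_bounded_eventually h ?_
  filter_upwards [h.tendsto_cofinite_zero.eventually_lt_const one_pos] with i hi
  have hlt : b i < 1 := lt_of_not_ge fun hge => hi.not_ge (Real.one_le_rpow hge hr0.le)
  rw [Real.norm_of_nonneg (hb i)]
  exact Real.self_le_rpow_of_le_one (hb i) hlt.le hr1

variable [NormedAddCommGroup E] [NormedSpace ℂ E] [NormedAddCommGroup F] [NormedSpace ℂ F]
  {x' : ι → E →L[ℂ] ℂ} {y : ι → F} {r : ℝ}

theorem summable_norm_smulRight (hr0 : 0 < r) (hr1 : r ≤ 1)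
    (h : Summable fun i => ‖x' i‖ ^ r * ‖y i‖ ^ r) :
    Summable fun i => ‖(x' i).smulRight (y i)‖ := by
  simp only [ContinuousLinearMap.norm_smulRight_apply]
  refine summable_of_summable_rpow (fun i => by positivity) hr0 hr1 (h.congr fun i => ?_)
  rw [Real.mul_rpow (norm_nonneg _) (norm_nonneg _)]

variable [Countable ι]

theorem IsRNuclear.of_hasSum {T : E →L[ℂ] F} (hr : r ≠ 0)
    (hT : ∀ x, HasSum (fun i => x' i x • y i) (T x))
    (h : Summable fun i => ‖x' i‖ ^ r * ‖y i‖ ^ r) : IsRNuclear r T := by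
  obtain ⟨e, he⟩ := exists_injective_nat ι
  let z : ℕ → (E →L[ℂ] ℂ) × F := Function.extend e (fun i => (x' i, y i)) 0
  refine ⟨fun n => (z n).1, fun n => (z n).2, fun x => ?_, ?_⟩
  · have hz : (fun n => (z n).1 x • (z n).2) = Function.extend e (fun i => x' i x • y i) 0 :=
      funext fun n =>
        (Function.apply_extend (fun w : (E →L[ℂ] ℂ) × F => w.1 x • w.2) e 0 n).trans
          (congrFun (congrArg _ (funext fun _ => smul_zero _)) n)
    rw [hz, hasSum_extend_zero he]
    exact hT x
  · have hz : (fun n => ‖(z n).1‖ ^ r * ‖(z n).2‖ ^ r)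
        = Function.extend e (fun i => ‖x' i‖ ^ r * ‖y i‖ ^ r) 0 :=
      funext fun n =>
        (Function.apply_extend (fun w : (E →L[ℂ] ℂ) × F => ‖w.1‖ ^ r * ‖w.2‖ ^ r) e 0 n).trans
          (congrFun (congrArg _ (funext fun _ => by simp [Real.zero_rpow hr])) n)
    rw [hz, summable_extend_zero he]
    exact h

theorem isRNuclear_tsum_smulRight [CompleteSpace F] (hr0 : 0 < r) (hr1 : r ≤ 1)
    (h : Summable fun i => ‖x' i‖ ^ r * ‖y i‖ ^ r) :
    IsRNuclear r (∑' i, (x' i).smulRight (y i)) :=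
  .of_hasSum hr0.ne' (fun x => (summable_norm_smulRight hr0 hr1 h).of_norm.hasSum.mapL
    (ContinuousLinearMap.apply ℂ F x)) h

theorem ae_hasSum_tsum_smulRight [CompleteSpace F] {X : Type*} [MeasurableSpace X]
    {μ : Measure X} {p : ℝ≥0∞} [Fact (1 ≤ p)] {y : ι → Lp F p μ}
    (h : Summable fun i => ‖(x' i).smulRight (y i)‖) (v : E) :
    ∀ᵐ x ∂μ, HasSum (fun i => x' i v • y i x) ((∑' i, (x' i).smulRight (y i)) v x) := by
  have hv : Summable fun i => ‖x' i v • y i‖ :=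
    .of_nonneg_of_le (fun _ => norm_nonneg _)
      (fun i => ((x' i).smulRight (y i)).le_opNorm v) (h.mul_right ‖v‖)
  have hsum : (∑' i, (x' i).smulRight (y i)) v = ∑' i, x' i v • y i :=
    (h.of_norm.hasSum.mapL (ContinuousLinearMap.apply ℂ (Lp F p μ) v)).tsum_eq.symm
  have hcoe : ∀ᵐ x ∂μ, ∀ i, (x' i v • y i : Lp F p μ) x = x' i v • y i x :=
    ae_all_iff.2 fun i => Lp.coeFn_smul (x' i v) (y i)
  have htop : ∑' i, ‖x' i v • y i‖ₑ ≠ ⊤ :=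
    ENNReal.tsum_coe_ne_top_iff_summable.2 (NNReal.summable_coe.1 hv)
  filter_upwards [Lp.hasSum_coeFn_tsum htop, hcoe] with x hx hcoex
  simpa only [hsum, hcoex] using hx

end Nuclear

section Functional

variable {X : Type*} [MeasurableSpace X]

theorem lintegral_enorm_mul_le_of_norm_le_one {μ : Measure X} {f g : X → ℂ}
    (hf : AEStronglyMeasurable f μ) (hg : AEStronglyMeasurable g μ) (hg1 : ∀ x, ‖g x‖ ≤ 1)
    {q : ℝ} (hq1 : 1 ≤ q) (hq2 : q ≤ 2) :
    ∫⁻ x, ‖f x * g x‖ₑ ∂μ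
      ≤ (∫⁻ x, ‖f x‖ₑ ^ q ∂μ) ^ (1 / q) * (∫⁻ x, ‖g x‖ₑ ^ (2 : ℝ) ∂μ) ^ (1 - 1 / q) := by
  have hq0 : 0 < q := by linarith
  have hθ0 : 0 ≤ 1 - 1 / q := by rwa [sub_nonneg, div_le_one hq0]
  have hθ1 : 2 * (1 - 1 / q) ≤ 1 := by linarith [one_div_le_one_div_of_le hq0 hq2]
  have hpow x : ‖g x‖ₑ ≤ (‖g x‖ₑ ^ (2 : ℝ)) ^ (1 - 1 / q) := by
    have hgx : ‖g x‖ₑ ≤ 1 := ofReal_norm (g x) ▸ ENNReal.ofReal_le_one.2 (hg1 x)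
    simpa only [← ENNReal.rpow_mul, ENNReal.rpow_one]
      using ENNReal.rpow_le_rpow_of_exponent_ge hgx hθ1
  calc ∫⁻ x, ‖f x * g x‖ₑ ∂μ
      ≤ ∫⁻ x, (‖f x‖ₑ ^ q) ^ (1 / q) * (‖g x‖ₑ ^ (2 : ℝ)) ^ (1 - 1 / q) ∂μ := by
        refine lintegral_mono fun x => ?_
        rw [enorm_mul, ← ENNReal.rpow_mul, mul_one_div_cancel hq0.ne', ENNReal.rpow_one]
        exact mul_le_mul_right (hpow x) _
    _ ≤ _ := ENNReal.lintegral_mul_norm_pow_le (hf.enorm.pow_const _) (hg.enorm.pow_const _)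
        (by positivity) hθ0 (by ring)

theorem lintegral_enorm_rpow_two {F : Type*} [NormedAddCommGroup F] {μ : Measure X} {g : X → F}
    (hg : Integrable (fun x => ‖g x‖ ^ 2) μ) :
    ∫⁻ x, ‖g x‖ₑ ^ (2 : ℝ) ∂μ = ENNReal.ofReal (∫ x, ‖g x‖ ^ 2 ∂μ) := by
  rw [ofReal_integral_eq_lintegral_ofReal hg (ae_of_all _ fun x => by positivity)]
  refine lintegral_congr fun x => ?_
  rw [ENNReal.ofReal_pow (norm_nonneg _), ofReal_norm, ENNReal.rpow_two]

variable [TopologicalSpace X] [CompactSpace X] [BorelSpace X] (μ : Measure X)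
  (p : ℝ≥0∞) [Fact (1 ≤ p)]

/-- The functional `f ↦ ∫ f g` on `L^p` for a continuous function `g` on a compact space. -/
def integralMulCLM [IsFiniteMeasure μ] (g : C(X, ℂ)) : Lp ℂ p μ →L[ℂ] ℂ :=
  haveI : Fact (1 ≤ p.conjExponent) := ⟨ENNReal.HolderConjugate.one_le p.conjExponent p⟩
  ((ContinuousLinearMap.mul ℂ ℂ).lpPairing μ p p.conjExponent).flip
    (ContinuousMap.toLp p.conjExponent μ ℂ g)

theorem integralMulCLM_apply [IsFiniteMeasure μ] (g : C(X, ℂ)) (f : Lp ℂ p μ) :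
    integralMulCLM μ p g f = ∫ x, f x * g x ∂μ := by
  have : Fact (1 ≤ p.conjExponent) := ⟨ENNReal.HolderConjugate.one_le p.conjExponent p⟩
  rw [integralMulCLM, ContinuousLinearMap.flip_apply, ContinuousLinearMap.lpPairing_eq_integral]
  refine integral_congr_ae ?_
  filter_upwards [ContinuousMap.coeFn_toLp (p := p.conjExponent) (𝕜 := ℂ) μ g] with x hx
  rw [hx, ContinuousLinearMap.mul_apply']

theorem norm_integralMulCLM_le [IsProbabilityMeasure μ] (g : C(X, ℂ)) (hg : ∀ x, ‖g x‖ ≤ 1) :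
    ‖integralMulCLM μ p g‖ ≤ (∫ x, ‖g x‖ ^ 2 ∂μ) ^ (1 - 1 / (min 2 p).toReal) := by
  have hp1 : 1 ≤ p := Fact.out
  have hmin : min 2 p ≠ ⊤ := ne_top_of_le_ne_top (by simp) (min_le_left _ _)
  have hmin1 : 1 ≤ min 2 p := le_min (by norm_num) hp1
  set q := (min 2 p).toReal with hq
  have hq1 : 1 ≤ q := by simpa using ENNReal.toReal_mono hmin hmin1
  have hq2 : q ≤ 2 := by simpa using ENNReal.toReal_mono (by simp) (min_le_left 2 p)
  have hθ : 0 ≤ 1 - 1 / q := by rwa [sub_nonneg, div_le_one (by linarith)]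
  have hg0 : 0 ≤ ∫ x, ‖g x‖ ^ 2 ∂μ := integral_nonneg fun x => by positivity
  have hgsq := lintegral_enorm_rpow_two (integrable_of_continuous (μ := μ)
    (f := fun x => ‖g x‖ ^ 2) (by fun_prop))
  refine ContinuousLinearMap.opNorm_le_bound _ (Real.rpow_nonneg hg0 _) fun f => ?_
  have hf := Lp.aestronglyMeasurable f
  have hfq : (∫⁻ x, ‖f x‖ₑ ^ q ∂μ) ^ (1 / q) ≤ ‖f‖ₑ := by
    rw [hq, ← eLpNorm_eq_lintegral_rpow_enorm_toReal (one_pos.trans_le hmin1).ne' hmin,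
      Lp.enorm_def]
    exact eLpNorm_le_eLpNorm_of_exponent_le (min_le_right _ _) hf
  have hbound : ‖integralMulCLM μ p g f‖ₑ
      ≤ ENNReal.ofReal ((∫ x, ‖g x‖ ^ 2 ∂μ) ^ (1 - 1 / q)) * ‖f‖ₑ := by
    calc ‖integralMulCLM μ p g f‖ₑ ≤ ∫⁻ x, ‖f x * g x‖ₑ ∂μ := by
          rw [integralMulCLM_apply]
          exact enorm_integral_le_lintegral_enorm _
      _ ≤ _ := lintegral_enorm_mul_le_of_norm_le_one hf g.continuous.aestronglyMeasurable hg
          hq1 hq2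
      _ ≤ _ := by
          rw [hgsq, ENNReal.ofReal_rpow_of_nonneg hg0 hθ, mul_comm]
          gcongr
  simpa only [ENNReal.toReal_mul, toReal_enorm, ENNReal.toReal_ofReal (Real.rpow_nonneg hg0 _)]
    using ENNReal.toReal_mono (by finiteness) hbound

end Functional

/-! ### The operator with a given symbol -/

section Symbol

variable {G : Type*} [Group G] [TopologicalSpace G]

namespace IrrepMatrix

/-- The function `d_ξ (ξ σ)ᵢⱼ`: the coefficient of `f̂(ξ)ⱼᵢ` when the trace in the series for `T f`
is expanded. -/
def symbolEntry (ξ : IrrepMatrix G) (σ : G → Matrix (Fin ξ.dim) (Fin ξ.dim) ℂ) (i j : Fin ξ.dim)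
    (x : G) : ℂ :=
  ξ.dim * (ξ.mat x * σ x) i j

variable (ξ : IrrepMatrix G)

theorem norm_mat_mul_apply_le (B : Matrix (Fin ξ.dim) (Fin ξ.dim) ℂ) (x : G) (i j : Fin ξ.dim) :
    ‖(ξ.mat x * B) i j‖ ≤ (opNormLinfty Bᵀ : ℝ) := by
  calc ‖(ξ.mat x * B) i j‖ ≤ ∑ k, ‖ξ.mat x i k * B k j‖ := by
        rw [Matrix.mul_apply]
        exact norm_sum_le _ _
    _ ≤ ∑ k, ‖B k j‖ := by
        refine Finset.sum_le_sum fun k _ => ?_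
        rw [norm_mul]
        exact mul_le_of_le_one_left (norm_nonneg _) (ξ.norm_mat_apply_le x i k)
    _ = ((∑ k, ‖Bᵀ j k‖₊ : ℝ≥0) : ℝ) := by push_cast; rfl
    _ ≤ (opNormLinfty Bᵀ : ℝ) := by
        exact_mod_cast Finset.le_sup (f := fun i => ∑ k, ‖Bᵀ i k‖₊) (Finset.mem_univ j)

variable [MeasurableSpace G] (μ : Measure G)

section Entries

variable {ξ μ} {σ : G → Matrix (Fin ξ.dim) (Fin ξ.dim) ℂ} {p : ℝ≥0∞}

theorem eLpNorm_symbolEntry_le (i j : Fin ξ.dim) :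
    eLpNorm (ξ.symbolEntry σ i j) p μ
      ≤ ξ.dim * eLpNorm (fun x => (opNormLinfty (σ x)ᵀ : ℝ)) p μ := by
  rw [← ENNReal.ofReal_natCast]
  refine eLpNorm_le_mul_eLpNorm_of_ae_le_mul (ae_of_all _ fun x => ?_) p
  rw [symbolEntry, norm_mul, Complex.norm_natCast, Real.norm_of_nonneg (NNReal.coe_nonneg _)]
  gcongr
  exact norm_mat_mul_apply_le ξ _ x i j

theorem memLp_symbolEntry [OpensMeasurableSpace G]
    (hσ : ∀ i j, AEStronglyMeasurable (fun x => σ x i j) μ)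
    (hN : eLpNorm (fun x => (opNormLinfty (σ x)ᵀ : ℝ)) p μ ≠ ⊤) (i j : Fin ξ.dim) :
    MemLp (ξ.symbolEntry σ i j) p μ := by
  refine ⟨?_, (eLpNorm_symbolEntry_le i j).trans_lt
    (ENNReal.mul_lt_top (ENNReal.natCast_lt_top _) hN.lt_top)⟩
  unfold symbolEntry
  simp_rw [Matrix.mul_apply]
  exact aestronglyMeasurable_const.mul (Finset.aestronglyMeasurable_fun_sum _ fun k _ =>
    (ξ.continuous_mat_apply i k).aestronglyMeasurable.mul (hσ k j))

theorem norm_toLp_symbolEntry_le {i j : Fin ξ.dim} (h : MemLp (ξ.symbolEntry σ i j) p μ)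
    (hN : eLpNorm (fun x => (opNormLinfty (σ x)ᵀ : ℝ)) p μ ≠ ⊤) :
    ‖h.toLp‖ ≤ ξ.dim * (eLpNorm (fun x => (opNormLinfty (σ x)ᵀ : ℝ)) p μ).toReal := by
  rw [Lp.norm_toLp]
  simpa using ENNReal.toReal_mono (by finiteness) (eLpNorm_symbolEntry_le (σ := σ) i j)

end Entries

theorem sum_fourierCoeff_mul_symbolEntry (σ : G → Matrix (Fin ξ.dim) (Fin ξ.dim) ℂ) (f : G → ℂ)
    (x : G) :
    ∑ k : Fin ξ.dim × Fin ξ.dim, fourierCoeff μ f ξ k.2 k.1 * ξ.symbolEntry σ k.1 k.2 x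
      = ξ.dim * (ξ.mat x * σ x * fourierCoeff μ f ξ).trace := by
  simp only [Fintype.sum_prod_type, Matrix.trace, Matrix.diag_apply, Finset.mul_sum,
    Matrix.mul_apply (M := ξ.mat x * σ x), symbolEntry]
  exact Finset.sum_congr rfl fun i _ => Finset.sum_congr rfl fun j _ => by ring

variable [CompactSpace G] [BorelSpace G]

/-- The functional `f ↦ f̂(ξ)ᵢⱼ` on `L^p`. -/
def fourierFunctional [IsFiniteMeasure μ] (p : ℝ≥0∞) [Fact (1 ≤ p)] (i j : Fin ξ.dim) :
    Lp ℂ p μ →L[ℂ] ℂ :=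
  integralMulCLM μ p (star (ξ.coeff j i))

theorem fourierFunctional_apply [IsFiniteMeasure μ] (p : ℝ≥0∞) [Fact (1 ≤ p)] (i j : Fin ξ.dim)
    (f : Lp ℂ p μ) : ξ.fourierFunctional μ p i j f = fourierCoeff μ f ξ i j :=
  integralMulCLM_apply μ p _ f

variable [IsTopologicalGroup G]

section FourierCoeff

variable [μ.IsMulLeftInvariant]

theorem fourierCoeff_mat_apply [IsProbabilityMeasure μ] (i j : Fin ξ.dim) {f : G → ℂ}
    (hf : f =ᵐ[μ] fun x => ξ.mat x i j) :
    fourierCoeff μ f ξ = Matrix.single j i (ξ.dim : ℂ)⁻¹ := by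
  ext b a
  calc fourierCoeff μ f ξ b a = ∫ x, ξ.mat x i j * star (ξ.mat x a b) ∂μ :=
        integral_congr_ae (hf.mono fun x hx => congrArg (· * star (ξ.mat x a b)) hx)
    _ = _ := by simp only [integral_mat_mul_star, Matrix.single_apply, and_comm]

variable {ξ} in
theorem fourierCoeff_mat_apply_of_not_equivalent [IsFiniteMeasure μ] {η : IrrepMatrix G}
    (h : ¬ ξ.Equivalent η) (i j : Fin η.dim) {f : G → ℂ} (hf : f =ᵐ[μ] fun x => η.mat x i j) :
    fourierCoeff μ f ξ = 0 := by
  ext b a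
  calc fourierCoeff μ f ξ b a = ∫ x, η.mat x i j * star (ξ.mat x a b) ∂μ :=
        integral_congr_ae (hf.mono fun x hx => congrArg (· * star (ξ.mat x a b)) hx)
    _ = 0 := integral_mat_mul_star_of_not_equivalent μ h i j a b

end FourierCoeff

variable [IsProbabilityMeasure μ] [μ.IsMulLeftInvariant]

theorem integral_norm_sq_mat_apply (i j : Fin ξ.dim) :
    ∫ x, ‖ξ.mat x i j‖ ^ 2 ∂μ = (ξ.dim : ℝ)⁻¹ := by
  have h := integral_mat_mul_star ξ μ i j i j
  simp only [RCLike.star_def, Complex.mul_conj', and_self, if_true, ← Complex.ofReal_pow,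
    integral_complex_ofReal] at h
  exact Complex.ofReal_injective (by rw [h, Complex.ofReal_inv, Complex.ofReal_natCast])

theorem norm_fourierFunctional_le (p : ℝ≥0∞) [Fact (1 ≤ p)] (i j : Fin ξ.dim) :
    ‖ξ.fourierFunctional μ p i j‖ ≤ ((ξ.dim : ℝ)⁻¹) ^ (1 - 1 / (min 2 p).toReal) := by
  have h := norm_integralMulCLM_le μ p (star (ξ.coeff j i))
    fun x => (norm_star _).trans_le (ξ.norm_mat_apply_le x j i)
  simpa only [fourierFunctional, ContinuousMap.star_apply, norm_star, coeff_apply,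
    ξ.integral_norm_sq_mat_apply μ] using h

theorem sum_norm_fourierFunctional_rpow_mul_norm_symbolEntry_rpow_le {r : ℝ} (hr : 0 ≤ r)
    {p₁ p₂ : ℝ≥0∞} [Fact (1 ≤ p₁)] {σ : G → Matrix (Fin ξ.dim) (Fin ξ.dim) ℂ}
    (hσ : ∀ i j, MemLp (ξ.symbolEntry σ i j) p₂ μ)
    (hN : eLpNorm (fun x => (opNormLinfty (σ x)ᵀ : ℝ)) p₂ μ ≠ ⊤) :
    ∑ k : Fin ξ.dim × Fin ξ.dim,
        ‖ξ.fourierFunctional μ p₁ k.2 k.1‖ ^ r * ‖(hσ k.1 k.2).toLp‖ ^ r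
      ≤ (ξ.dim : ℝ) ^ (2 + r / (min 2 p₁).toReal) *
        (eLpNorm (fun x => (opNormLinfty (σ x)ᵀ : ℝ)) p₂ μ).toReal ^ r := by
  set d : ℝ := (ξ.dim : ℝ)
  set q := (min 2 p₁).toReal
  set N := (eLpNorm (fun x => (opNormLinfty (σ x)ᵀ : ℝ)) p₂ μ).toReal
  have hd : 0 < d := Nat.cast_pos.2 ξ.dim_pos
  have hN0 : 0 ≤ N := ENNReal.toReal_nonneg
  calc _ ≤ ∑ _k : Fin ξ.dim × Fin ξ.dim, ((d⁻¹) ^ (1 - 1 / q)) ^ r * (d * N) ^ r := by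
        refine Finset.sum_le_sum fun k _ => mul_le_mul
          (Real.rpow_le_rpow (norm_nonneg _) (ξ.norm_fourierFunctional_le μ p₁ k.2 k.1) hr)
          (Real.rpow_le_rpow ENNReal.toReal_nonneg (norm_toLp_symbolEntry_le (hσ k.1 k.2) hN) hr)
          (Real.rpow_nonneg ENNReal.toReal_nonneg r) (by positivity)
    _ = d ^ (2 : ℝ) * (((d⁻¹) ^ (1 - 1 / q)) ^ r * (d * N) ^ r) := by
        simp [d, sq]
    _ = d ^ (2 + r / q) * N ^ r := by
        rw [Real.mul_rpow hd.le hN0, Real.inv_rpow hd.le, ← Real.rpow_neg hd.le,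
          ← Real.rpow_mul hd.le, ← mul_assoc, ← mul_assoc, ← Real.rpow_add hd, ← Real.rpow_add hd]
        congr 2
        ring

end IrrepMatrix

variable [IsTopologicalGroup G] [CompactSpace G] [MeasurableSpace G] [BorelSpace G]
  (μ : Measure G) [IsProbabilityMeasure μ] [μ.IsMulLeftInvariant]

theorem exists_isRNuclear_of_symbol {ι : Type*} [Countable ι] {r : ℝ} (hr0 : 0 < r) (hr1 : r ≤ 1)
    {p₁ p₂ : ℝ≥0∞} [Fact (1 ≤ p₁)] [Fact (1 ≤ p₂)] (ξ : ι → IrrepMatrix G)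
    {σ : ∀ c, G → Matrix (Fin (ξ c).dim) (Fin (ξ c).dim) ℂ}
    (hσ : ∀ c i j, AEStronglyMeasurable (fun x => σ c x i j) μ)
    (hsum : ∑' c, ((ξ c).dim : ℝ≥0∞) ^ (2 + r / (min 2 p₁).toReal) *
      (eLpNorm (fun x => (opNormLinfty (σ c x)ᵀ : ℝ)) p₂ μ) ^ r < ⊤) :
    ∃ T : Lp ℂ p₁ μ →L[ℂ] Lp ℂ p₂ μ, IsRNuclear r T ∧ ∀ f : Lp ℂ p₁ μ, ∀ᵐ x ∂μ, HasSum
      (fun c => ((ξ c).dim : ℂ) * ((ξ c).mat x * σ c x * fourierCoeff μ f (ξ c)).trace)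
      (T f x) := by
  have hN c : eLpNorm (fun x => (opNormLinfty (σ c x)ᵀ : ℝ)) p₂ μ ≠ ⊤ := fun h => by
    have hdim : ((ξ c).dim : ℝ≥0∞) ^ (2 + r / (min 2 p₁).toReal) ≠ 0 :=
      (ENNReal.rpow_pos (by exact_mod_cast (ξ c).dim_pos) (ENNReal.natCast_ne_top _)).ne'
    refine ENNReal.ne_top_of_tsum_ne_top hsum.ne c ?_
    rw [h, ENNReal.top_rpow_of_pos hr0, ENNReal.mul_top hdim]
  have hentry c (i j : Fin (ξ c).dim) : MemLp ((ξ c).symbolEntry (σ c) i j) p₂ μ :=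
    IrrepMatrix.memLp_symbolEntry (hσ c) (hN c) i j
  let x' (k : Σ c, Fin (ξ c).dim × Fin (ξ c).dim) := (ξ k.1).fourierFunctional μ p₁ k.2.2 k.2.1
  let y (k : Σ c, Fin (ξ c).dim × Fin (ξ c).dim) := (hentry k.1 k.2.1 k.2.2).toLp
  have hsummable : Summable fun k => ‖x' k‖ ^ r * ‖y k‖ ^ r := by
    refine (summable_sigma_of_nonneg fun k => by positivity).2 ⟨fun c => Summable.of_finite, ?_⟩
    refine (ENNReal.summable_toReal hsum.ne).of_nonneg_of_le
      (fun c => tsum_nonneg fun _ => by positivity) fun c => ?_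
    rw [tsum_fintype, ENNReal.toReal_mul, ← ENNReal.toReal_rpow, ← ENNReal.toReal_rpow,
      ENNReal.toReal_natCast]
    exact (ξ c).sum_norm_fourierFunctional_rpow_mul_norm_symbolEntry_rpow_le μ hr0.le (hentry c)
      (hN c)
  refine ⟨∑' k, (x' k).smulRight (y k), isRNuclear_tsum_smulRight hr0 hr1 hsummable, fun f => ?_⟩
  have hy : ∀ᵐ x ∂μ, ∀ k, y k x = (ξ k.1).symbolEntry (σ k.1) k.2.1 k.2.2 x :=
    ae_all_iff.2 fun k => (hentry k.1 k.2.1 k.2.2).coeFn_toLp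
  filter_upwards [ae_hasSum_tsum_smulRight (summable_norm_smulRight hr0 hr1 hsummable) f, hy]
    with x hx hyx
  simp only [hyx, x', smul_eq_mul, IrrepMatrix.fourierFunctional_apply] at hx
  simpa only [IrrepMatrix.sum_fourierCoeff_mul_symbolEntry] using
    hx.sigma fun c => hasSum_fintype _

theorem IsChoiceOfRepresentatives.hasSum_trace_fourierCoeff {ξ : UnitaryDual G → IrrepMatrix G}
    (hξ : IsChoiceOfRepresentatives ξ)
    (σ : ∀ c : UnitaryDual G, G → Matrix (Fin (ξ c).dim) (Fin (ξ c).dim) ℂ)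
    (c : UnitaryDual G) (i j : Fin (ξ c).dim) {f : G → ℂ}
    (hf : f =ᵐ[μ] fun x => (ξ c).mat x i j) (x : G) :
    HasSum (fun c : UnitaryDual G =>
      ((ξ c).dim : ℂ) * ((ξ c).mat x * σ c x * fourierCoeff μ f (ξ c)).trace)
      (((ξ c).mat x * σ c x) i j) := by
  have hd : ((ξ c).dim : ℂ) ≠ 0 := Nat.cast_ne_zero.2 (ξ c).dim_pos.ne'
  convert hasSum_single c fun c' hc' => ?_ using 1
  · rw [IrrepMatrix.fourierCoeff_mat_apply (ξ c) μ i j hf, Matrix.trace_mul_single, op_smul_eq_mul]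
    field_simp
  · rw [IrrepMatrix.fourierCoeff_mat_apply_of_not_equivalent μ (hξ.not_equivalent hc') i j hf,
      Matrix.mul_zero, Matrix.trace_zero, mul_zero]

end Symbol

/-! ### Operators on smooth functions -/

section Extension

variable {E : Type*} [NormedAddCommGroup E] [NormedSpace ℝ E]
  {H : Type*} [TopologicalSpace H] {I : ModelWithCorners ℝ E H}
  {G : Type*} [TopologicalSpace G] [ChartedSpace H G] [MeasurableSpace G]

theorem SmoothFun.coeFn_toLp [CompactSpace G] [BorelSpace G] (μ : Measure G) [IsFiniteMeasure μ]
    (p : ℝ≥0∞) (f : SmoothFun I G) : f.toLp p μ =ᵐ[μ] f :=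
  MemLp.coeFn_toLp _

variable [Group G]

variable (I G) in
/-- The inclusion of `C^∞(G)` into `C(G)`. -/
def SmoothFun.toContinuousMapCLM [CompactSpace G] : SmoothFun I G →L[ℂ] C(G, ℂ) where
  toFun f := ⟨f, f.continuous⟩
  map_add' _ _ := rfl
  map_smul' _ _ := rfl
  cont := continuous_iff_continuousAt.2 fun _ =>
    ContinuousMap.tendsto_iff_tendstoUniformly.2 (SmoothFun.tendsto_iff.1 tendsto_id [])

theorem SmoothFun.toLp_eq_toLp_toContinuousMapCLM [CompactSpace G] [BorelSpace G] (μ : Measure G)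
    [IsFiniteMeasure μ] (p : ℝ≥0∞) [Fact (1 ≤ p)] (f : SmoothFun I G) :
    f.toLp p μ = ContinuousMap.toLp p μ ℂ (SmoothFun.toContinuousMapCLM I G f) :=
  Lp.ext ((f.coeFn_toLp μ p).trans (ContinuousMap.coeFn_toLp (𝕜 := ℂ) μ
    (SmoothFun.toContinuousMapCLM I G f)).symm)

variable {μ : Measure G} {ξ : UnitaryDual G → IrrepMatrix G}

theorem IsMatrixSymbol.apply_coeff {A : SmoothFun I G →L[ℂ] Distrib I G}
    {σ : ∀ c : UnitaryDual G, G → Matrix (Fin (ξ c).dim) (Fin (ξ c).dim) ℂ}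
    (hA : IsMatrixSymbol A μ ξ σ) {c : UnitaryDual G} {i j : Fin (ξ c).dim} {u : SmoothFun I G}
    (hu : ∀ x, u x = (ξ c).mat x i j) (φ : SmoothFun I G) :
    A u φ = ∫ x, ((ξ c).mat x * σ c x) i j * φ x ∂μ := by
  obtain ⟨Aξ, hAξ, hσ⟩ := hA c
  rw [(hAξ i j u hu).2 φ]
  refine integral_congr_ae ?_
  filter_upwards [hσ] with x hx
  rw [hx, ← Matrix.mul_assoc, (ξ c).mat_mul_conjTranspose, Matrix.one_mul]

variable [FiniteDimensional ℝ E] [I.Boundaryless] [LieGroup I ∞ G] [IsTopologicalGroup G]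
  [CompactSpace G] [T2Space G] [SecondCountableTopology G] [BorelSpace G] [μ.IsHaarMeasure]
  [IsProbabilityMeasure μ] (hξ : IsChoiceOfRepresentatives ξ)

variable (μ) in
include μ hξ in
theorem SmoothFun.clm_ext_of_coeff {F : Type*} [AddCommGroup F] [Module ℂ F] [TopologicalSpace F]
    [T2Space F] {L M : SmoothFun I G →L[ℂ] F}
    (h : ∀ c i j (u : SmoothFun I G), (∀ x, u x = (ξ c).mat x i j) → L u = M u) : L = M :=
  ContinuousLinearMap.coe_injective <| LinearMap.eqLocus_eq_top.1 <|
    SmoothFun.eq_top_of_isClosed_of_coeff_mem μ hξ h (isClosed_eq L.continuous M.continuous)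

include hξ in
theorem IsMatrixSymbol.isRepresentedBy {A : SmoothFun I G →L[ℂ] Distrib I G}
    {σ : ∀ c : UnitaryDual G, G → Matrix (Fin (ξ c).dim) (Fin (ξ c).dim) ℂ}
    (hA : IsMatrixSymbol A μ ξ σ) {p₁ p₂ : ℝ≥0∞} [Fact (1 ≤ p₁)] [Fact (1 ≤ p₂)]
    {T : Lp ℂ p₁ μ →L[ℂ] Lp ℂ p₂ μ}
    (hT : ∀ f : Lp ℂ p₁ μ, ∀ᵐ x ∂μ, HasSum (fun c : UnitaryDual G =>
      ((ξ c).dim : ℂ) * ((ξ c).mat x * σ c x * fourierCoeff μ f (ξ c)).trace) (T f x))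
    (f : SmoothFun I G) : (A f).IsRepresentedBy (T (f.toLp p₁ μ)) μ := by
  refine ⟨(Lp.memLp _).integrable Fact.out, fun φ => ?_⟩
  let pairA : SmoothFun I G →L[ℂ] ℂ := (PointwiseConvergenceCLM.evalCLM (RingHom.id ℂ) ℂ φ).comp A
  let pairT : SmoothFun I G →L[ℂ] ℂ :=
    integralMulCLM μ p₂ (SmoothFun.toContinuousMapCLM I G φ) ∘L T ∘L ContinuousMap.toLp p₁ μ ℂ ∘L
      SmoothFun.toContinuousMapCLM I G
  have hpairT u : pairT u = ∫ x, T (u.toLp p₁ μ) x * φ x ∂μ := by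
    rw [u.toLp_eq_toLp_toContinuousMapCLM μ p₁]
    exact integralMulCLM_apply μ p₂ _ _
  have hpair : pairA = pairT := SmoothFun.clm_ext_of_coeff μ hξ fun c i j u hu => by
    refine (hA.apply_coeff hu φ).trans ((integral_congr_ae ?_).trans (hpairT u).symm)
    have hcoeff : u.toLp p₁ μ =ᵐ[μ] fun x => (ξ c).mat x i j :=
      (u.coeFn_toLp μ p₁).trans (ae_of_all _ hu)
    filter_upwards [hT (u.toLp p₁ μ)] with x hx
    rw [hx.unique (hξ.hasSum_trace_fourierCoeff μ σ c i j hcoeff x)]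
  exact (DFunLike.congr_fun hpair f).trans (hpairT f)

end Extension

end RNuclear

end

open RNuclear in
theorem mainTheorem1_general
    {E : Type*} [NormedAddCommGroup E] [NormedSpace ℝ E] [FiniteDimensional ℝ E]
    {H : Type*} [TopologicalSpace H] (I : ModelWithCorners ℝ E H) [I.Boundaryless]
    (G : Type*) [Group G] [TopologicalSpace G] [ChartedSpace H G] [LieGroup I ∞ G]
    [CompactSpace G] [T2Space G] [MeasurableSpace G] [BorelSpace G]
    (μ : Measure G) [μ.IsHaarMeasure] [IsProbabilityMeasure μ]
    (r : ℝ) (hr0 : 0 < r) (hr1 : r ≤ 1)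
    (p₁ p₂ : ℝ≥0∞) [Fact (1 ≤ p₁)] [Fact (1 ≤ p₂)]
    (ξ : UnitaryDual G → IrrepMatrix G) (hξ : IsChoiceOfRepresentatives ξ)
    (σ : ∀ c : UnitaryDual G, G → Matrix (Fin (ξ c).dim) (Fin (ξ c).dim) ℂ)
    (hσ : ∀ c i j, AEStronglyMeasurable (fun x => σ c x i j) μ)
    (hsum : ∑' c : UnitaryDual G, ((ξ c).dim : ℝ≥0∞) ^ (2 + r / (min 2 p₁).toReal) *
      (eLpNorm (fun x => (opNormLinfty (σ c x)ᵀ : ℝ)) p₂ μ) ^ r < ⊤) :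
    ∃ T : Lp ℂ p₁ μ →L[ℂ] Lp ℂ p₂ μ,
      IsRNuclear r T ∧
      (∀ f : Lp ℂ p₁ μ, ∀ᵐ x ∂μ, HasSum
        (fun c : UnitaryDual G =>
          ((ξ c).dim : ℂ) * ((ξ c).mat x * σ c x * fourierCoeff μ f (ξ c)).trace) (T f x)) ∧
      ∀ A : SmoothFun I G →L[ℂ] Distrib I G, IsMatrixSymbol A μ ξ σ →
        ∀ f : SmoothFun I G, (A f).IsRepresentedBy (T (f.toLp p₁ μ)) μ := by
  have : IsTopologicalGroup G := topologicalGroup_of_lieGroup I ∞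
  have : SecondCountableTopology H := I.secondCountableTopology
  have : SecondCountableTopology G := ChartedSpace.secondCountable_of_sigmaCompact H G
  have : Countable (UnitaryDual G) := hξ.countable_unitaryDual μ
  obtain ⟨T, hT, hTsum⟩ := exists_isRNuclear_of_symbol μ hr0 hr1 ξ hσ hsum
  exact ⟨T, hT, hTsum, fun A hA f => hA.isRepresentedBy hξ hTsum f⟩

open RNuclear in
theorem mainTheorem1
    {E : Type*} [NormedAddCommGroup E] [NormedSpace ℝ E] [FiniteDimensional ℝ E]
    {H : Type*} [TopologicalSpace H] (I : ModelWithCorners ℝ E H) [I.Boundaryless]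
    (G : Type*) [Group G] [TopologicalSpace G] [ChartedSpace H G] [LieGroup I ∞ G]
    [CompactSpace G] [T2Space G] [MeasurableSpace G] [BorelSpace G]
    (μ : Measure G) [μ.IsHaarMeasure] [IsProbabilityMeasure μ]
    (r : ℝ) (hr0 : 0 < r) (hr1 : r ≤ 1)
    (p₁ p₂ : ℝ≥0∞) [Fact (1 ≤ p₁)] [Fact (1 ≤ p₂)] (hp₁ : p₁ ≠ ⊤) (hp₂ : p₂ ≠ ⊤)
    (ξ : UnitaryDual G → IrrepMatrix G) (hξ : IsChoiceOfRepresentatives ξ)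
    (σ : ∀ c : UnitaryDual G, G → Matrix (Fin (ξ c).dim) (Fin (ξ c).dim) ℂ)
    (hσ : ∀ c i j, AEStronglyMeasurable (fun x => σ c x i j) μ)
    (hsum : ∑' c : UnitaryDual G, ((ξ c).dim : ℝ≥0∞) ^ (2 + r / (min 2 p₁).toReal) *
      (eLpNorm (fun x => (opNormLinfty (σ c x)ᵀ : ℝ)) p₂ μ) ^ r < ⊤) :
    ∃ T : Lp ℂ p₁ μ →L[ℂ] Lp ℂ p₂ μ,
      IsRNuclear r T ∧
      (∀ f : Lp ℂ p₁ μ, ∀ᵐ x ∂μ, HasSum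
        (fun c : UnitaryDual G =>
          ((ξ c).dim : ℂ) * ((ξ c).mat x * σ c x * fourierCoeff μ f (ξ c)).trace) (T f x)) ∧
      ∀ A : SmoothFun I G →L[ℂ] Distrib I G, IsMatrixSymbol A μ ξ σ →
        ∀ f : SmoothFun I G, (A f).IsRepresentedBy (T (f.toLp p₁ μ)) μ := by
  exact mainTheorem1_general I G μ r hr0 hr1 p₁ p₂ ξ hξ σ hσ hsum
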